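/- **Setting.** Let $N,s$ be dimensions, let $\mathcal M$ (channel inputs) and $\mathcal M'$ (channel outputs) be finite alphabets, and consider $$x_{t+1}=f(x_t,w_t)+Bu_t,\qquad t\ge 0,$$ with $x_t,w_t\in\mathbb R^N$, $u_t\in\mathbb R^s$, $B$ a linear map, $w_0,w_1,\dots$ i.i.d. with law $\nu$ and $(w_t)_{t\ge0}$ independent of $x_0$. Assume that $f$ is jointly Borel measurable, and that for every $w$ the map $f_w=f(\cdot,w):\mathbb R^N\to\mathbb R^N$ is continuously differentiable and bijective. Write $|J(f(x,w))|$ for the absolute value of the determinant of the Jacobian of $f_w$ at $x$, and assume that there are $L_1,M_1\in\mathbb R$ with $L_1\le\log_2|J(f(x,w))|\le M_1$ for all $x,w$ (in particular the determinant never vanishes). *Channel and policies.* A channel is a family of conditional probabilities $P(q'_t\mid q_{[0,t]},q'_{[0,t-1]})$ on $\mathcal M'$, $t\ge0$, where $y_{[0,t]}=(y_0,\dots,y_t)$. An admissible policy consists of (measurable) maps giving the channel input $q_t=\gamma^e_t(x_{[0,t]},q'_{[0,t-1]})\in\mathcal M$ and the control $u_t=\gamma_t(q'_{[0,t]})\in\mathbb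 R^s$. *Class A.* The directed information is $I(q_{[0,T-1]}\to q'_{[0,T-1]})=\sum_{t=0}^{T-1}I(q_{[0,t]};q'_t\mid q'_{[0,t-1]})$ (no conditioning for $t=0$), in bits. The channel is of Class A if 1. for all $t\ge0$ and all $S\subseteq\mathcal M'$, almost surely $P(q'_t\in S\mid q_{[0,t]},q'_{[0,t-1]},x_0,(w_r)_{r\ge0})=P(q'_t\in S\mid q_{[0,t]},q'_{[0,t-1]})$; and 2. its capacity with feedback $C$ (the supremum of the rates, in bits per channel use, at which block codes with noiseless output feedback achieve vanishing error probability) is given by $$C=\lim_{T\to\infty}\ \sup_{\{P(q_t\mid q_{[0,t-1]},q'_{[0,t-1]})\}_{0\le t\le T-1}}\ \frac1T\, I(q_{[0,T-1]}\to q'_{[0,T-1]}).$$ *Entropy.* $h(x)=-\int p\log_2 p$ is the differential entropy of a random vector $x$ with density $p$, as an extended real number. **Theorem.** Consider this system, controlled over a Class A channel under an admissible policy, and suppose that $x_0$ has a density and that $h(x_0)$ is finite. Let $\pi_t$ be the law of $x_t$. a) If $\liminf_{t\to\infty}h(x_t)/t\le0$, then $$C\ \ge\ \liminf_{T\to\infty}\frac1T\sum_{t=0}^{T-1}\int\pi_t(dx)\int\nu(dw)\,\log_2|J(f(x,w))|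 .$$ b) If $\limsup_{t\to\infty}h(x_t)/t\le0$, then $$C\ \ge\ \limsup_{T\to\infty}\frac1T\sum_{t=0}^{T-1}\int\pi_t(dx)\int\nu(dw)\,\log_2|J(f(x,w))| .$$ In either case, $C\ge L$, where $L:=\inf_{x,w}\log_2|J(f(x,w))|$. -/

import Mathlib

open MeasureTheory ProbabilityTheory Filter Topology

namespace NetworkedControl

noncomputable section

/-- The Euclidean space `ℝⁿ`. -/
abbrev Vec (n : ℕ) : Type := EuclideanSpace ℝ (Fin n)

/-! ### Finite-alphabet information quantities (base 2) -/

/-- The probability that `X = s` under the mass function `p` on a finite space. -/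
def massOf {Ω S : Type*} [Fintype Ω] (p : Ω → ℝ) (X : Ω → S) (s : S) : ℝ :=
  open Classical in ∑ ω, if X ω = s then p ω else 0

/-- `H(X)` under the mass function `p`. -/
def finEntropy {Ω S : Type*} [Fintype Ω] [Fintype S] (p : Ω → ℝ) (X : Ω → S) : ℝ :=
  -∑ s, massOf p X s * Real.logb 2 (massOf p X s)

/-- `H(X | Y) = H(X, Y) - H(Y)`. -/
def finCondEntropy {Ω S S' : Type*} [Fintype Ω] [Fintype S] [Fintype S']
    (p : Ω → ℝ) (X : Ω → S) (Y : Ω → S') : ℝ :=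
  finEntropy p (fun ω => (X ω, Y ω)) - finEntropy p Y

/-- `I(X ; Y | Z) = H(X | Z) - H(X | Y, Z)`. -/
def finCondMutualInfo {Ω S S' S'' : Type*} [Fintype Ω] [Fintype S] [Fintype S'] [Fintype S'']
    (p : Ω → ℝ) (X : Ω → S) (Y : Ω → S') (Z : Ω → S'') : ℝ :=
  finCondEntropy p X Z - finCondEntropy p X (fun ω => (Y ω, Z ω))

/-! ### Channels with memory and feedback -/

/-- The first `n` entries of a word of length `T ≥ n`. -/
def initSeg {S : Type*} {n T : ℕ} (h : n ≤ T) (a : Fin T → S) : Fin n → S :=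
  fun i => a (Fin.castLE h i)

/-- A channel with finite input alphabet `A` and finite output alphabet `B`:
`prob t a b y` is the conditional probability of the output `y` at time `t`, given the inputs
`a = q_{[0,t]}` and the past outputs `b = q'_{[0,t-1]}`. -/
structure Channel (A B : Type*) [Fintype B] where
  prob : (t : ℕ) → (Fin (t + 1) → A) → (Fin t → B) → B → ℝ
  prob_nonneg : ∀ t a b y, 0 ≤ prob t a b y
  prob_sum : ∀ t a b, ∑ y, prob t a b y = 1

/-- A family of conditional input distributions `P(q_t | q_{[0,t-1]}, q'_{[0,t-1]})`, `t ≥ 0`. -/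
structure InputLaw (A B : Type*) [Fintype A] where
  prob : (t : ℕ) → (Fin t → A) → (Fin t → B) → A → ℝ
  prob_nonneg : ∀ t a b z, 0 ≤ prob t a b z
  prob_sum : ∀ t a b, ∑ z, prob t a b z = 1

section Channel

variable {A B : Type*} [Fintype A] [Fintype B]

/-- The joint mass function of `(q_{[0,T-1]}, q'_{[0,T-1]})`. -/
def jointMass (W : Channel A B) (P : InputLaw A B) (T : ℕ)
    (ab : (Fin T → A) × (Fin T → B)) : ℝ :=
  ∏ t : Fin T,
    P.prob t (initSeg t.2.le ab.1) (initSeg t.2.le ab.2) (ab.1 t) *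
      W.prob t (initSeg t.2 ab.1) (initSeg t.2.le ab.2) (ab.2 t)

/-- The directed information
`I(q_{[0,T-1]} → q'_{[0,T-1]}) = ∑_{t < T} I(q'_t ; q_{[0,t]} | q'_{[0,t-1]})`
(for `t = 0` the conditioning is void). -/
def directedInfo (W : Channel A B) (P : InputLaw A B) (T : ℕ) : ℝ :=
  ∑ t : Fin T, finCondMutualInfo (jointMass W P T)
    (fun ab => ab.2 t)
    (fun ab => (initSeg t.2 ab.1 : Fin (t + 1) → A))
    (fun ab => (initSeg t.2.le ab.2 : Fin t → B))

/-- The largest normalized directed information over the horizon `T`. -/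
def maxDirectedRate (W : Channel A B) (T : ℕ) : ℝ :=
  ⨆ P : InputLaw A B, directedInfo W P T / T

end Channel

/-- A block code with noiseless output feedback, of length `n`, for the messages `0, …, m - 1`. -/
structure FeedbackCode (A B : Type*) (n m : ℕ) where
  enc : (t : ℕ) → Fin m → (Fin t → B) → A
  dec : (Fin n → B) → Fin m

/-- The inputs that the code sends before time `t ≤ n` when the message is `i` and the
outputs are `b`. -/
def FeedbackCode.inputs {A B : Type*} {n m : ℕ} (c : FeedbackCode A B n m) (i : Fin m)
    (b : Fin n → B) {t : ℕ} (h : t ≤ n) : Fin t → A :=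
  fun s => c.enc s i (initSeg (s.2.le.trans h) b)

/-- The probability of receiving the output word `b` when the message is `i`. -/
def FeedbackCode.outputMass {A B : Type*} [Fintype B] {n m : ℕ} (W : Channel A B)
    (c : FeedbackCode A B n m) (i : Fin m) (b : Fin n → B) : ℝ :=
  ∏ t : Fin n, W.prob t (c.inputs i b t.2) (initSeg t.2.le b) (b t)

/-- The average probability of a decoding error, for a uniformly distributed message. -/
def FeedbackCode.errorProb {A B : Type*} [Fintype B] {n m : ℕ} (W : Channel A B)
    (c : FeedbackCode A B n m) : ℝ :=
  open Classical in
  (∑ i : Fin m, ∑ b : Fin n → B, if c.dec b = i then 0 else c.outputMass W i b) / m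

/-- `R` is an achievable rate (in bits per channel use) with feedback. -/
def AchievableRate {A B : Type*} [Fintype B] (W : Channel A B) (R : ℝ) : Prop :=
  ∀ ε : ℝ, 0 < ε → ∀ᶠ n : ℕ in atTop, ∃ m : ℕ, 0 < m ∧ (2 : ℝ) ^ (n * R) ≤ m ∧
    ∃ c : FeedbackCode A B n m, c.errorProb W ≤ ε

/-- The (operational) capacity with feedback: the supremum of the achievable rates. -/
def feedbackCapacity {A B : Type*} [Fintype B] (W : Channel A B) : ℝ :=
  sSup {R : ℝ | 0 ≤ R ∧ AchievableRate W R}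

/-! ### Differential entropy -/

/-- The differential entropy `-∫ p log₂ p` of a law with Lebesgue density `p`, as an extended
real number: the integral of the positive part of `-p log₂ p` minus that of its negative part.
A law without a density gets the value `-∞`. -/
def diffEntropy {n : ℕ} (μ : Measure (Vec n)) : EReal :=
  open Classical in
  if μ ≪ (volume : Measure (Vec n)) then
    ((∫⁻ x, ENNReal.ofReal
        (-((μ.rnDeriv volume x).toReal * Real.logb 2 (μ.rnDeriv volume x).toReal)) : ENNReal) :
        EReal)
      - ((∫⁻ x, ENNReal.ofReal
        ((μ.rnDeriv volume x).toReal * Real.logb 2 (μ.rnDeriv volume x).toReal) : ENNReal) :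
        EReal)
  else ⊥

/-- The law `μ` has a density and a finite differential entropy. -/
def HasFiniteDiffEntropy {n : ℕ} (μ : Measure (Vec n)) : Prop :=
  μ ≪ (volume : Measure (Vec n)) ∧ diffEntropy μ ≠ ⊤ ∧ diffEntropy μ ≠ ⊥

/-! ### The controlled system -/

/-- The determinant of the Jacobian of `f(·, w)` at `x`. -/
def jacDet {N : ℕ} (f : Vec N → Vec N → Vec N) (x w : Vec N) : ℝ :=
  (fderiv ℝ (fun y => f y w) x).det

/-- `log₂ |J(f(x, w))|`. -/
def logJac {N : ℕ} (f : Vec N → Vec N → Vec N) (x w : Vec N) : ℝ :=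
  Real.logb 2 |jacDet f x w|

/-- The history `y_{[0,n-1]}` of a process. -/
def hist {Ω S : Type*} (y : ℕ → Ω → S) (n : ℕ) (ω : Ω) : Fin n → S :=
  fun i => y i ω

/-- A causal (admissible) coding and control policy. -/
structure Policy (N s : ℕ) (A B : Type*) [MeasurableSpace A] [MeasurableSpace B] where
  /-- `q_t = enc t x_{[0,t]} q'_{[0,t-1]}` -/
  enc : (t : ℕ) → (Fin (t + 1) → Vec N) → (Fin t → B) → A
  measurable_enc : ∀ t, Measurable (Function.uncurry (enc t))
  /-- `u_t = ctrl t q'_{[0,t]}` -/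
  ctrl : (t : ℕ) → (Fin (t + 1) → B) → Vec s

/-- The processes `x` (state), `w` (noise), `q` (channel input), `q'` (channel output) form the
closed loop of the system `x_{t+1} = f(x_t, w_t) + B u_t` over the channel `W` under the policy
`γ`, where the noise is i.i.d. with law `ν` and independent of `x_0`. -/
structure IsClosedLoop {Ω A B : Type*} [MeasurableSpace Ω] (P : Measure Ω) {N s : ℕ}
    [Fintype B] [MeasurableSpace A] [MeasurableSpace B]
    (f : Vec N → Vec N → Vec N) (Bm : Vec s →L[ℝ] Vec N) (ν : Measure (Vec N))
    (W : Channel A B) (γ : Policy N s A B)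
    (x w : ℕ → Ω → Vec N) (q : ℕ → Ω → A) (q' : ℕ → Ω → B) : Prop where
  measurable_init : Measurable (x 0)
  measurable_noise : ∀ t, Measurable (w t)
  measurable_output : ∀ t, Measurable (q' t)
  noise_law : ∀ t, P.map (w t) = ν
  noise_indep : iIndepFun w P
  init_indep : IndepFun (x 0) (fun ω t => w t ω) P
  input_eq : ∀ t ω, q t ω = γ.enc t (hist x (t + 1) ω) (hist q' t ω)
  state_eq : ∀ t ω, x (t + 1) ω = f (x t ω) (w t ω) + Bm (γ.ctrl t (hist q' (t + 1) ω))
  output_law : ∀ t (y : B),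
    P⟦q' t ⁻¹' {y} |
        MeasurableSpace.comap (fun ω => (hist q (t + 1) ω, hist q' t ω)) inferInstance⟧
      =ᵐ[P] fun ω => W.prob t (hist q (t + 1) ω) (hist q' t ω) y

/-- The channel `W`, used with inputs `q` and outputs `q'` in a loop driven by `x0` and `w`, is of
Class A: given `q_{[0,t]}` and `q'_{[0,t-1]}`, the output `q'_t` is conditionally independent of
`(x_0, w)`, and the capacity with feedback is the limit of the maximal normalized directed
informations. -/
structure IsClassA {Ω A B : Type*} [MeasurableSpace Ω] (P : Measure Ω) {N : ℕ}
    [Fintype A] [Fintype B] [MeasurableSpace A] [MeasurableSpace B]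
    (W : Channel A B) (x0 : Ω → Vec N) (w : ℕ → Ω → Vec N)
    (q : ℕ → Ω → A) (q' : ℕ → Ω → B) : Prop where
  markov : ∀ t (S : Set B), MeasurableSet S →
    P⟦q' t ⁻¹' S |
        MeasurableSpace.comap
          (fun ω => (hist q (t + 1) ω, hist q' t ω, x0 ω, fun r => w r ω)) inferInstance⟧
      =ᵐ[P]
    P⟦q' t ⁻¹' S |
        MeasurableSpace.comap (fun ω => (hist q (t + 1) ω, hist q' t ω)) inferInstance⟧
  capacity : Tendsto (fun T => maxDirectedRate W T) atTop (𝓝 (feedbackCapacity W))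

/-- The time average `(1/T) ∑_{t < T} ∫ π_t(dx) ∫ ν(dw) log₂ |J(f(x, w))|`, with `π_t` the law
of `x_t`. -/
def avgLogJac {Ω : Type*} [MeasurableSpace Ω] (P : Measure Ω) {N : ℕ}
    (f : Vec N → Vec N → Vec N) (ν : Measure (Vec N)) (x : ℕ → Ω → Vec N) (T : ℕ) : ℝ :=
  (1 / (T : ℝ)) * ∑ t ∈ Finset.range T, ∫ y, (∫ v, logJac f y v ∂ν) ∂(P.map (x t))

end

end NetworkedControl

namespace NetworkedControl

/-! ### Pointwise inequalities for `u log u` -/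

/-! Consider the joint entropy of the state `x_t` and the output word `q'_{[0,t-1]}`. It is computed
from the finite measures `lawOn P (x t) (hist q' t ⁻¹' {b})`, one for each word `b`. Two moves lead
from time `t` to time `t + 1`.

Appending `q'_t`: by Class A, `q'_t` is independent of `x_t` given the words of inputs and outputs,
so the joint entropy grows by at least `H(q'_t | q_{[0,t]}, q'_{[0,t-1]})`
(`sum_negEnt_mixture_le`). Applying the dynamics: on a fixed output word the control is constant and
`w_t` is independent of `x_t`. Conditioning on `w_t` can only lower the entropy, and for fixed `w_t`
the map is a bijection, so the entropy grows by at least the mean of `log |J|` (`push_entropy`).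

Telescoping from `x_0`, and bounding the final joint entropy by `h(x_T) + H(q'_{[0,T-1]})`
(`negEnt_sum_le`), the sum of the means of `log |J|` is at most `h(x_T) - h(x_0) + H(q'_{[0,T-1]}) -
∑ H(q'_t | q_{[0,t]}, q'_{[0,t-1]})`. The last difference of entropies is the directed information
of the loop (`directedInfo_eq`), hence at most `T * maxDirectedRate W T`. Dividing by `T` along
times at which `h(x_T) / T` is small gives the claim.

Entropies may be infinite. The value `-∞` is excluded forwards in time, from `x_0` (`LowerFinite`).
The value `+∞` can occur, so integrability is transported backwards: if `h(x_T)` is not `+∞`, then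
all joint entropies up to time `T` are finite. Every inequality is carried by `log z ≤ z - 1`, and
the negative of entropy, in nats, is used throughout. -/

theorem mul_log_le_mul_log_add {u v : ℝ} (hu : 0 ≤ u) (hv : 0 ≤ v) (h : v = 0 → u = 0) :
    u * Real.log v ≤ u * Real.log u + (v - u) := by
  rcases hu.eq_or_lt with rfl | hu
  · simpa using hv
  have hv' : 0 < v := hv.lt_of_ne fun h0 => hu.ne' (h h0.symm)
  -- The pointwise form of Gibbs' inequality: `log z ≤ z - 1` at `z = v / u`, multiplied by `u`.
  have h1 := Real.log_le_sub_one_of_pos (div_pos hv' hu)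
  rw [Real.log_div hv'.ne' hu.ne'] at h1
  have h2 := mul_le_mul_of_nonneg_left h1 hu.le
  have h3 : u * (v / u - 1) = v - u := by field_simp
  linarith

/-- Concavity of entropy, not normalized: with weights `k a / g`, the mixture of the laws `V a` has
at least the average of their entropies. Later `k a` is the density at one point of the state law on
the input word `a`. -/
theorem sum_mul_log_mixture_le {ι Y : Type*} [Fintype ι] [Fintype Y] {V : ι → Y → ℝ}
    (hV : ∀ a y, 0 ≤ V a y) (hV1 : ∀ a, ∑ y, V a y = 1) {k : ι → ℝ} (hk : ∀ a, 0 ≤ k a) :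
    ∑ y, (∑ a, V a y * k a) * Real.log (∑ a, V a y * k a) ≤
      (∑ a, k a) * Real.log (∑ a, k a) + ∑ a, k a * ∑ y, V a y * Real.log (V a y) := by
  set g := ∑ a, k a with hg
  have hg0 : 0 ≤ g := Finset.sum_nonneg fun a _ => hk a
  have hsum : ∑ y, ∑ a, V a y * k a = g := by
    rw [Finset.sum_comm]
    simp [← Finset.sum_mul, hV1, hg]
  rcases hg0.eq_or_lt with h0 | hpos
  · have hk0 : ∀ a, k a = 0 := fun a =>
      (Finset.sum_eq_zero_iff_of_nonneg fun a _ => hk a).1 (hg.symm.trans h0.symm) a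
        (Finset.mem_univ a)
    simp [hk0, ← h0]
  have key : ∀ y, (∑ a, V a y * k a) * Real.log (∑ a, V a y * k a) ≤
      (∑ a, V a y * k a) * Real.log g + ∑ a, k a * (V a y * Real.log (V a y)) := by
    intro y
    set gy := ∑ a, V a y * k a with hgy
    have hle : ∀ a, V a y * k a ≤ gy := fun a =>
      Finset.single_le_sum (f := fun a => V a y * k a) (fun a _ => mul_nonneg (hV a y) (hk a))
        (Finset.mem_univ a)
    have hgy0 : 0 ≤ gy := Finset.sum_nonneg fun a _ => mul_nonneg (hV a y) (hk a)
    -- Gibbs' inequality between `V a` and the normalized mixture `gy / g`. After summation over `a`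
    -- the linear corrections cancel.
    have h1 : ∀ a, k a * V a y * Real.log (gy / g) ≤
        k a * (V a y * Real.log (V a y)) + (k a * (gy / g) - V a y * k a) := by
      intro a
      rcases (hk a).eq_or_lt with h | h
      · simp [← h]
      have := mul_log_le_mul_log_add (hV a y) (div_nonneg hgy0 hg0) (fun h0 => by
        have hgy' : gy = 0 := by
          rcases div_eq_zero_iff.1 h0 with h' | h'
          · exact h'
          · exact absurd h' hpos.ne'
        have h2 := hle a
        rw [hgy'] at h2
        have h3 := mul_nonneg (hV a y) (hk a)
        rcases mul_eq_zero.1 (le_antisymm h2 h3) with h' | h'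
        · exact h'
        · exact absurd h' h.ne')
      have := mul_le_mul_of_nonneg_left this h.le
      linarith
    have h2 := Finset.sum_le_sum fun a (_ : a ∈ Finset.univ) => h1 a
    rw [← Finset.sum_mul, Finset.sum_add_distrib, Finset.sum_sub_distrib, ← Finset.sum_mul,
      ← hgy, ← hg] at h2
    have h3 : ∑ a, k a * V a y = gy := by simp [hgy, mul_comm]
    rw [h3, mul_div_cancel₀ _ hpos.ne'] at h2
    rcases hgy0.eq_or_lt with h | h
    · rw [← h] at h2 ⊢
      simpa using h2
    · rw [Real.log_div h.ne' hpos.ne'] at h2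
      linarith
  refine (Finset.sum_le_sum fun y _ => key y).trans (le_of_eq ?_)
  rw [Finset.sum_add_distrib, ← Finset.sum_mul, hsum, Finset.sum_comm]
  simp [Finset.mul_sum]

/-- The function `u log u` decreases near `0`, but there it is negative; truncation at `0` restores
monotonicity. This lets a larger density control a smaller one. -/
theorem max_zero_mul_log_mono {u v : ℝ} (hu : 0 ≤ u) (huv : u ≤ v) :
    max 0 (u * Real.log u) ≤ max 0 (v * Real.log v) := by
  refine max_le (le_max_left _ _) ?_
  rcases le_total u 1 with h | h
  · exact (mul_nonpos_of_nonneg_of_nonpos hu (Real.log_nonpos hu h)).trans (le_max_left _ _)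
  · exact (mul_le_mul huv (Real.log_le_log (by linarith) huv) (Real.log_nonneg h)
      (by linarith)).trans (le_max_right _ _)

/-! ### Densities and entropies of finite measures -/

section Density

variable {n : ℕ}

/-- The real-valued Lebesgue density of a measure. -/
noncomputable def dens (μ : Measure (Vec n)) (x : Vec n) : ℝ := (μ.rnDeriv volume x).toReal

/-- The function `g log g`, where `g` is the density of `μ`. -/
noncomputable def densLog (μ : Measure (Vec n)) (x : Vec n) : ℝ :=
  dens μ x * Real.log (dens μ x)

/-- The negative `∫ g log g` of the entropy in nats of a measure with density `g`. -/
noncomputable def negEnt (μ : Measure (Vec n)) : ℝ := ∫ x, densLog μ x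

/-- The positive part of `g log g` is integrable, that is, the entropy is not `-∞`. -/
def LowerFinite (μ : Measure (Vec n)) : Prop := Integrable (fun x => max 0 (densLog μ x)) volume

theorem dens_nonneg (μ : Measure (Vec n)) (x : Vec n) : 0 ≤ dens μ x := ENNReal.toReal_nonneg

theorem measurable_dens (μ : Measure (Vec n)) : Measurable (dens μ) :=
  (Measure.measurable_rnDeriv _ _).ennreal_toReal

theorem measurable_densLog (μ : Measure (Vec n)) : Measurable (densLog μ) :=
  (measurable_dens μ).mul (Real.measurable_log.comp (measurable_dens μ))

theorem integrable_dens (μ : Measure (Vec n)) [IsFiniteMeasure μ] : Integrable (dens μ) :=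
  Measure.integrable_toReal_rnDeriv

theorem integral_dens {μ : Measure (Vec n)} [IsFiniteMeasure μ] (h : μ ≪ volume) :
    ∫ x, dens μ x = μ.real Set.univ :=
  Measure.integral_toReal_rnDeriv h

theorem dens_pos_ae {μ : Measure (Vec n)} [IsFiniteMeasure μ] (h : μ ≪ volume) :
    ∀ᵐ x ∂μ, 0 < dens μ x := by
  filter_upwards [Measure.rnDeriv_pos h, h.ae_le (Measure.rnDeriv_ne_top μ volume)] with x h1 h2
  exact ENNReal.toReal_pos h1.ne' h2

theorem ofReal_dens_ae (μ : Measure (Vec n)) [IsFiniteMeasure μ] :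
    ∀ᵐ x, ENNReal.ofReal (dens μ x) = μ.rnDeriv volume x := by
  filter_upwards [Measure.rnDeriv_ne_top μ volume] with x h
  exact ENNReal.ofReal_toReal h

theorem integrable_densLog_iff {μ : Measure (Vec n)} [IsFiniteMeasure μ] (h : μ ≪ volume) :
    Integrable (densLog μ) volume ↔ Integrable (fun x => Real.log (dens μ x)) μ :=
  integrable_rnDeriv_smul_iff h

theorem negEnt_eq {μ : Measure (Vec n)} [IsFiniteMeasure μ] (h : μ ≪ volume) :
    negEnt μ = ∫ x, Real.log (dens μ x) ∂μ :=
  integral_rnDeriv_smul h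

theorem lowerFinite_iff {μ : Measure (Vec n)} [IsFiniteMeasure μ] (h : μ ≪ volume) :
    LowerFinite μ ↔ Integrable (fun x => max 0 (Real.log (dens μ x))) μ := by
  rw [LowerFinite, ← integrable_rnDeriv_smul_iff h]
  refine iff_of_eq (congrArg (fun F => Integrable F volume) (funext fun x => ?_))
  change _ = dens μ x * _
  rw [mul_max_of_nonneg _ _ (dens_nonneg μ x), mul_zero]
  rfl

theorem dens_sum_smul {ι : Type*} (s : Finset ι) (c : ι → NNReal) (κ : ι → Measure (Vec n))
    [∀ a, IsFiniteMeasure (κ a)] :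
    dens (∑ a ∈ s, c a • κ a) =ᵐ[volume] fun x => ∑ a ∈ s, (c a : ℝ) * dens (κ a) x := by
  classical
  induction s using Finset.induction_on with
  | empty =>
    filter_upwards [Measure.rnDeriv_zero (volume : Measure (Vec n))] with x hx
    simp [dens, hx]
  | insert a s ha ih =>
    simp only [Finset.sum_insert ha]
    filter_upwards [ih, Measure.rnDeriv_add (c a • κ a) (∑ a ∈ s, c a • κ a) volume,
      Measure.rnDeriv_smul_left (κ a) volume (c a), Measure.rnDeriv_ne_top (κ a) volume,
      Measure.rnDeriv_ne_top (∑ a ∈ s, c a • κ a) volume] with x h1 h2 h3 h4 h5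
    rw [← h1]
    simp only [dens, h2, Pi.add_apply, h3, Pi.smul_apply]
    rw [ENNReal.toReal_add (by
      rw [ENNReal.smul_def]
      exact ENNReal.mul_ne_top ENNReal.coe_ne_top h4) h5]
    rw [ENNReal.toReal_smul, NNReal.smul_def, smul_eq_mul]

theorem dens_sum {ι : Type*} (s : Finset ι) (κ : ι → Measure (Vec n))
    [∀ a, IsFiniteMeasure (κ a)] :
    dens (∑ a ∈ s, κ a) =ᵐ[volume] fun x => ∑ a ∈ s, dens (κ a) x := by
  simpa using dens_sum_smul s (fun _ => 1) κ

/-! ### Appending a channel output: mixtures over input words -/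

section Mixture

variable {ι Y : Type*} [Fintype ι] [Fintype Y] {V : ι → Y → ℝ}
  (hV : ∀ a y, 0 ≤ V a y) (hV1 : ∀ a, ∑ y, V a y = 1) (κ : ι → Measure (Vec n))
  [∀ a, IsFiniteMeasure (κ a)]

include hV in
theorem dens_mixture :
    ∀ᵐ x, ∀ y, dens (∑ a, (V a y).toNNReal • κ a) x = ∑ a, V a y * dens (κ a) x := by
  rw [ae_all_iff]
  intro y
  filter_upwards [dens_sum_smul Finset.univ (fun a => (V a y).toNNReal) κ] with x hx
  rw [hx]
  simp [hV]

-- Since `V a y ≤ 1`, the density of the mixture is dominated by that of `∑ a, κ a`, and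
-- `max_zero_mul_log_mono` applies.
include hV hV1 in
theorem LowerFinite.mixture (h : LowerFinite (∑ a, κ a)) (y : Y) :
    LowerFinite (∑ a, (V a y).toNNReal • κ a) := by
  refine Integrable.mono h ((measurable_const.max (measurable_densLog _)).aestronglyMeasurable) ?_
  filter_upwards [dens_mixture hV κ, dens_sum Finset.univ κ] with x hx hs
  rw [Real.norm_of_nonneg (le_max_left _ _), Real.norm_of_nonneg (le_max_left _ _), densLog,
    densLog]
  refine max_zero_mul_log_mono (dens_nonneg _ _) ?_
  rw [hx, hs]
  refine Finset.sum_le_sum fun a _ => mul_le_of_le_one_left (dens_nonneg _ _) ?_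
  rw [← hV1 a]
  exact Finset.single_le_sum (f := fun y => V a y) (fun y _ => hV a y) (Finset.mem_univ y)

include hV hV1 in
theorem densLog_mixture_ae :
    ∀ᵐ x, ∑ y, densLog (∑ a, (V a y).toNNReal • κ a) x ≤
      densLog (∑ a, κ a) x + ∑ a, dens (κ a) x * ∑ y, V a y * Real.log (V a y) := by
  filter_upwards [dens_mixture hV κ, dens_sum Finset.univ κ] with x hx hs
  simp only [densLog, hx, hs]
  exact sum_mul_log_mixture_le hV hV1 fun a => dens_nonneg (κ a) x

-- The backward transport of integrability: the concavity inequality bounds `densLog (∑ a, κ a)`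
-- below by integrable functions, and its positive part bounds it above.
include hV hV1 in
theorem integrable_densLog_of_mixture (h : LowerFinite (∑ a, κ a))
    (hint : ∀ y, Integrable (densLog (∑ a, (V a y).toNNReal • κ a))) :
    Integrable (densLog (∑ a, κ a)) := by
  refine integrable_of_le_of_le
    (g₁ := fun x => ∑ y, densLog (∑ a, (V a y).toNNReal • κ a) x -
      ∑ a, dens (κ a) x * ∑ y, V a y * Real.log (V a y))
    (measurable_densLog _).aestronglyMeasurable ?_
    (ae_of_all _ fun x => le_max_right 0 _) ?_ h
  · filter_upwards [densLog_mixture_ae hV hV1 κ] with x hx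
    linarith
  · exact (integrable_finsetSum _ fun y _ => hint y).sub
      (integrable_finsetSum _ fun a _ => (integrable_dens (κ a)).mul_const _)

-- Integrated concavity: an output drawn from `V a`, independently of the state given `a`, adds at
-- least its conditional entropy given `a`.
include hV hV1 in
theorem sum_negEnt_mixture_le (hac : ∀ a, κ a ≪ volume)
    (hint : ∀ y, Integrable (densLog (∑ a, (V a y).toNNReal • κ a)))
    (hint' : Integrable (densLog (∑ a, κ a))) :
    ∑ y, negEnt (∑ a, (V a y).toNNReal • κ a) ≤
      negEnt (∑ a, κ a) + ∑ a, (κ a).real Set.univ * ∑ y, V a y * Real.log (V a y) := by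
  have hk := fun a => (integrable_dens (κ a)).mul_const (∑ y, V a y * Real.log (V a y))
  have h1 := integral_mono_ae (integrable_finsetSum _ fun y _ => hint y)
    (hint'.add (integrable_finsetSum _ fun a _ => hk a)) (densLog_mixture_ae hV hV1 κ)
  rw [integral_finsetSum _ fun y _ => hint y] at h1
  refine h1.trans (le_of_eq ?_)
  simp only [Pi.add_apply]
  rw [integral_add hint' (integrable_finsetSum _ fun a _ => hk a),
    integral_finsetSum _ fun a _ => hk a]
  simp only [integral_mul_const, integral_dens (hac _)]
  rfl

end Mixture

/-! ### Forgetting the output word -/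

section Marginal

variable {β : Type*} [Fintype β] (m : β → Measure (Vec n)) [∀ b, IsFiniteMeasure (m b)]

theorem sum_real_univ [IsProbabilityMeasure (∑ b, m b)] : ∑ b, (m b).real Set.univ = 1 := by
  have h : (∑ b, m b).real Set.univ = 1 := probReal_univ
  rw [← h, measureReal_def, Measure.coe_finsetSum, Finset.sum_apply,
    ENNReal.toReal_sum fun b _ => measure_ne_top _ _]
  rfl

/-- Gibbs' inequality between the joint density and the product of the marginals. If the word `b`
has mass zero then `m b = 0`, so `log 0 = 0` does no harm. -/
theorem dens_mul_log_sum_le :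
    ∀ᵐ x, ∀ b, dens (m b) x * Real.log (dens (∑ b, m b) x) +
        dens (m b) x * Real.log ((m b).real Set.univ) ≤
      densLog (m b) x + ((m b).real Set.univ * dens (∑ b, m b) x - dens (m b) x) := by
  have h0 : ∀ᵐ x, ∀ b, (m b).real Set.univ = 0 → dens (m b) x = 0 := by
    rw [ae_all_iff]
    intro b
    by_cases h : (m b).real Set.univ = 0
    · have hz : m b = 0 := by
        rwa [measureReal_eq_zero_iff, Measure.measure_univ_eq_zero] at h
      filter_upwards [Measure.rnDeriv_zero (volume : Measure (Vec n))] with x hx _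
      rw [dens, hz, hx]
      rfl
    · exact ae_of_all _ fun x h' => absurd h' h
  filter_upwards [h0, dens_sum Finset.univ m] with x hx hs b
  have hle : dens (m b) x ≤ dens (∑ b, m b) x := by
    rw [hs]
    exact Finset.single_le_sum (f := fun b => dens (m b) x) (fun b _ => dens_nonneg _ _)
      (Finset.mem_univ b)
  refine le_trans (le_of_eq ?_) (mul_log_le_mul_log_add (dens_nonneg (m b) x)
    (mul_nonneg measureReal_nonneg (dens_nonneg (∑ b, m b) x)) fun h => ?_)
  · rcases (dens_nonneg (m b) x).eq_or_lt with h | h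
    · simp [← h]
    · rw [Real.log_mul (fun h' => h.ne' (hx b h')) (h.trans_le hle).ne']
      ring
  · rcases mul_eq_zero.1 h with h | h
    · exact hx b h
    · exact le_antisymm (hle.trans h.le) (dens_nonneg _ _)

theorem densLog_sum_le [IsProbabilityMeasure (∑ b, m b)] :
    ∀ᵐ x, densLog (∑ b, m b) x + ∑ b, dens (m b) x * Real.log ((m b).real Set.univ) ≤
      ∑ b, densLog (m b) x := by
  filter_upwards [dens_mul_log_sum_le m, dens_sum Finset.univ m] with x hx hs
  have h := Finset.sum_le_sum fun b (_ : b ∈ Finset.univ) => hx b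
  rw [Finset.sum_add_distrib, Finset.sum_add_distrib, Finset.sum_sub_distrib, ← Finset.sum_mul,
    ← Finset.sum_mul, sum_real_univ, ← hs, one_mul, sub_self, add_zero] at h
  exact h

theorem LowerFinite.sum [IsProbabilityMeasure (∑ b, m b)] (h : ∀ b, LowerFinite (m b)) :
    LowerFinite (∑ b, m b) := by
  refine Integrable.mono' (g := fun x => ∑ b, max 0 (densLog (m b) x) +
    ∑ b, dens (m b) x * |Real.log ((m b).real Set.univ)|)
    ((integrable_finsetSum _ fun b _ => h b).add
      (integrable_finsetSum _ fun b _ => (integrable_dens (m b)).mul_const _))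
    ((measurable_const.max (measurable_densLog _)).aestronglyMeasurable) ?_
  filter_upwards [densLog_sum_le m] with x hx
  rw [Real.norm_of_nonneg (le_max_left _ _)]
  have h1 : ∑ b, densLog (m b) x ≤ ∑ b, max 0 (densLog (m b) x) :=
    Finset.sum_le_sum fun b _ => le_max_right _ _
  have h2 : -∑ b, dens (m b) x * |Real.log ((m b).real Set.univ)| ≤
      ∑ b, dens (m b) x * Real.log ((m b).real Set.univ) := by
    rw [← Finset.sum_neg_distrib]
    refine Finset.sum_le_sum fun b _ => ?_
    rw [← mul_neg]
    exact mul_le_mul_of_nonneg_left (neg_abs_le _) (dens_nonneg _ _)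
  refine max_le (add_nonneg ?_ ?_) (by linarith)
  · exact Finset.sum_nonneg fun b _ => le_max_left _ _
  · exact Finset.sum_nonneg fun b _ => mul_nonneg (dens_nonneg _ _) (abs_nonneg _)

/-- The lower bound comes from comparison with the product of the marginals: as `dens (m b)` is at
most the total density, the cross term is at least `-|densLog (∑ b, m b)|`. -/
theorem integrable_densLog_of_sum (h : ∀ b, LowerFinite (m b))
    (hint : Integrable (densLog (∑ b, m b))) (b : β) : Integrable (densLog (m b)) := by
  refine integrable_of_le_of_le
    (g₁ := fun x => -|densLog (∑ b, m b) x| + dens (m b) x * Real.log ((m b).real Set.univ) -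
      ((m b).real Set.univ * dens (∑ b, m b) x - dens (m b) x))
    (measurable_densLog _).aestronglyMeasurable ?_ (ae_of_all _ fun x => le_max_right 0 _) ?_ (h b)
  · filter_upwards [dens_mul_log_sum_le m, dens_sum Finset.univ m] with x hx hs
    have hle : dens (m b) x ≤ dens (∑ b, m b) x := by
      rw [hs]
      exact Finset.single_le_sum (f := fun b => dens (m b) x) (fun b _ => dens_nonneg _ _)
        (Finset.mem_univ b)
    have h1 : -|densLog (∑ b, m b) x| ≤ dens (m b) x * Real.log (dens (∑ b, m b) x) := by
      refine le_trans (neg_le_neg ?_) (neg_abs_le _)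
      rw [densLog, abs_mul, abs_mul, abs_of_nonneg (dens_nonneg _ _),
        abs_of_nonneg (dens_nonneg _ _)]
      exact mul_le_mul_of_nonneg_right hle (abs_nonneg _)
    have h2 := hx b
    linarith
  · exact (hint.abs.neg.add ((integrable_dens _).mul_const _)).sub
      (((integrable_dens _).const_mul _).sub (integrable_dens _))

/-- Subadditivity: the joint entropy of state and word is at most the sum of the two entropies. -/
theorem negEnt_sum_le [IsProbabilityMeasure (∑ b, m b)] (hac : ∀ b, m b ≪ volume)
    (hint : Integrable (densLog (∑ b, m b)))
    (hint' : ∀ b, Integrable (densLog (m b))) :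
    negEnt (∑ b, m b) + ∑ b, (m b).real Set.univ * Real.log ((m b).real Set.univ) ≤
      ∑ b, negEnt (m b) := by
  have hk := fun b => (integrable_dens (m b)).mul_const (Real.log ((m b).real Set.univ))
  have h1 := integral_mono_ae (hint.add (integrable_finsetSum _ fun b _ => hk b))
    (integrable_finsetSum _ fun b _ => hint' b) (densLog_sum_le m)
  rw [integral_finsetSum _ fun b _ => hint' b] at h1
  refine le_trans (le_of_eq ?_) h1
  simp only [Pi.add_apply]
  rw [integral_add hint (integrable_finsetSum _ fun b _ => hk b),
    integral_finsetSum _ fun b _ => hk b]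
  simp only [integral_mul_const, integral_dens (hac _)]
  rfl

end Marginal

end Density

/-! ### Entropy growth under the noisy dynamics -/

section Pushforward

variable {n : ℕ} {F : Vec n → Vec n → Vec n}

theorem lintegral_change_of_variables (hdiff : ∀ w, Differentiable ℝ fun x => F x w)
    (hbij : ∀ w, Function.Bijective fun x => F x w) (w : Vec n) (h : Vec n → ENNReal) :
    ∫⁻ x, ENNReal.ofReal |jacDet F x w| * h (F x w) = ∫⁻ y, h y := by
  have := lintegral_image_eq_lintegral_abs_det_fderiv_mul (volume : Measure (Vec n))
    MeasurableSet.univ (fun x _ => ((hdiff w) x).hasFDerivAt.hasFDerivWithinAt)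
    (hbij w).injective.injOn h
  rw [Set.image_univ, (hbij w).surjective.range_eq, Measure.restrict_univ] at this
  exact this.symm

variable (hF : Measurable (Function.uncurry F)) (hdiff : ∀ w, Differentiable ℝ fun x => F x w)
  (hbij : ∀ w, Function.Bijective fun x => F x w) (hne : ∀ x w, jacDet F x w ≠ 0)
  (hJ : Measurable fun p : Vec n × Vec n => |jacDet F p.1 p.2|)
  (ρ ν : Measure (Vec n)) [IsFiniteMeasure ρ] [IsProbabilityMeasure ν] (hρ : ρ ≪ volume)

-- By Fubini it suffices to fix `w`. The change of variables then makes `|J|` integrate to zero over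
-- the preimage of a null set, and `|J|` never vanishes.
include hF hdiff hbij hne hρ in
theorem absolutelyContinuous_push : (ρ.prod ν).map (Function.uncurry F) ≪ volume := by
  refine Measure.AbsolutelyContinuous.mk fun E hE h0 => ?_
  rw [Measure.map_apply hF hE, Measure.prod_apply_symm (hF hE)]
  refine (lintegral_congr fun w => hρ ?_).trans lintegral_zero
  have hFw : Measurable fun x => F x w := hF.comp (measurable_id.prodMk measurable_const)
  have h1 := lintegral_change_of_variables hdiff hbij w (E.indicator 1)
  rw [lintegral_indicator_one hE, h0] at h1
  have h2 : ∀ᵐ x, ENNReal.ofReal |jacDet F x w| * E.indicator 1 (F x w) = 0 := by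
    refine (lintegral_eq_zero_iff' ?_).1 h1
    by_contra hm
    refine hm (AEMeasurable.mul ?_ ((measurable_one.indicator hE).comp hFw).aemeasurable)
    refine Measurable.aemeasurable (Measurable.ennreal_ofReal ?_)
    exact (ContinuousLinearMap.continuous_det.measurable.comp (measurable_fderiv ℝ _)).abs
  refine measure_mono_null ?_ (ae_iff.1 h2)
  intro x hx
  have hx' : F x w ∈ E := hx
  simp [hx', hne x w]

-- For fixed `w` the image of `ρ` has density `ρ / |J|` at the image point. The bound is `log z ≤ z
-- - 1`, with `z` the ratio of the averaged image density to this one.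
include hF hdiff hbij hne hρ in
theorem log_dens_push_le :
    ∀ᵐ p ∂(ρ.prod ν), Real.log (dens ((ρ.prod ν).map (Function.uncurry F)) (F p.1 p.2)) +
        Real.log |jacDet F p.1 p.2| - Real.log (dens ρ p.1) ≤
      dens ((ρ.prod ν).map (Function.uncurry F)) (F p.1 p.2) * |jacDet F p.1 p.2| / dens ρ p.1
        - 1 := by
  have h1 := ae_of_ae_map hF.aemeasurable
    (dens_pos_ae (absolutelyContinuous_push hF hdiff hbij hne ρ ν hρ))
  have h2 : ∀ᵐ p ∂(ρ.prod ν), 0 < dens ρ p.1 :=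
    Measure.quasiMeasurePreserving_fst.ae (dens_pos_ae hρ)
  filter_upwards [h1, h2] with p hp1 hp2
  have hp1' : 0 < dens ((ρ.prod ν).map (Function.uncurry F)) (F p.1 p.2) := hp1
  have hp3 : 0 < |jacDet F p.1 p.2| := abs_pos.2 (hne _ _)
  rw [← Real.log_mul hp1'.ne' hp3.ne', ← Real.log_div (mul_pos hp1' hp3).ne' hp2.ne']
  exact Real.log_le_sub_one_of_pos (div_pos (mul_pos hp1' hp3) hp2)

-- For each `w` the factor `dens ρ` cancels, and the change of variables leaves the total mass of
-- the pushforward. Points where `dens ρ` vanishes are lost, whence an inequality.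
include hF hdiff hbij hJ hρ in
theorem lintegral_dens_ratio_le :
    ∫⁻ p, ENNReal.ofReal (dens ((ρ.prod ν).map (Function.uncurry F)) (F p.1 p.2) *
      |jacDet F p.1 p.2| / dens ρ p.1) ∂(ρ.prod ν) ≤ ρ Set.univ := by
  set m := (ρ.prod ν).map (Function.uncurry F) with hm
  have hmeas : Measurable fun p : Vec n × Vec n =>
      ENNReal.ofReal (dens m (F p.1 p.2) * |jacDet F p.1 p.2| / dens ρ p.1) :=
    ((((measurable_dens m).comp hF).mul hJ).div
      ((measurable_dens ρ).comp measurable_fst)).ennreal_ofReal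
  rw [lintegral_prod_symm _ hmeas.aemeasurable]
  have hinner : ∀ w, ∫⁻ x, ENNReal.ofReal (dens m (F x w) * |jacDet F x w| / dens ρ x) ∂ρ ≤
      ρ Set.univ := by
    intro w
    have hmw : Measurable fun x =>
        ENNReal.ofReal (dens m (F x w) * |jacDet F x w| / dens ρ x) :=
      hmeas.comp (measurable_id.prodMk measurable_const)
    rw [← lintegral_rnDeriv_mul hρ hmw.aemeasurable]
    calc ∫⁻ x, ρ.rnDeriv volume x *
          ENNReal.ofReal (dens m (F x w) * |jacDet F x w| / dens ρ x)
        ≤ ∫⁻ x, ENNReal.ofReal |jacDet F x w| * ENNReal.ofReal (dens m (F x w)) := by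
          refine lintegral_mono_ae ?_
          filter_upwards [ofReal_dens_ae ρ] with x hx
          rw [← hx, ← ENNReal.ofReal_mul (dens_nonneg _ _), ← ENNReal.ofReal_mul (abs_nonneg _)]
          refine ENNReal.ofReal_le_ofReal ?_
          rcases (dens_nonneg ρ x).eq_or_lt with h | h
          · rw [← h, zero_mul]
            exact mul_nonneg (abs_nonneg _) (dens_nonneg _ _)
          · rw [mul_div_cancel₀ _ h.ne', mul_comm]
      _ = ∫⁻ y, ENNReal.ofReal (dens m y) :=
          lintegral_change_of_variables hdiff hbij w fun y => ENNReal.ofReal (dens m y)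
      _ = ∫⁻ y, m.rnDeriv volume y := lintegral_congr_ae (ofReal_dens_ae m)
      _ ≤ m Set.univ := Measure.lintegral_rnDeriv_le
      _ = ρ Set.univ := by
          rw [hm, Measure.map_apply hF MeasurableSet.univ, Set.preimage_univ, ← Set.univ_prod_univ,
            Measure.prod_prod, measure_univ (μ := ν), mul_one]
  calc _ ≤ ∫⁻ _, ρ Set.univ ∂ν := lintegral_mono hinner
    _ = ρ Set.univ := by simp

include hF hdiff hbij hJ hρ in
theorem integrable_dens_ratio :
    Integrable (fun p : Vec n × Vec n => dens ((ρ.prod ν).map (Function.uncurry F)) (F p.1 p.2) *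
      |jacDet F p.1 p.2| / dens ρ p.1) (ρ.prod ν) := by
  refine ⟨((((measurable_dens _).comp hF).mul hJ).div
      ((measurable_dens ρ).comp measurable_fst)).aestronglyMeasurable, ?_⟩
  rw [hasFiniteIntegral_iff_ofReal (ae_of_all _ fun p => by
    exact div_nonneg (mul_nonneg (dens_nonneg _ _) (abs_nonneg _)) (dens_nonneg _ _))]
  exact (lintegral_dens_ratio_le hF hdiff hbij hJ ρ ν hρ).trans_lt (measure_lt_top _ _)

include hF hdiff hbij hJ hρ in
theorem integral_dens_ratio_le :
    ∫ p, dens ((ρ.prod ν).map (Function.uncurry F)) (F p.1 p.2) *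
      |jacDet F p.1 p.2| / dens ρ p.1 ∂(ρ.prod ν) ≤ ρ.real Set.univ := by
  rw [integral_eq_lintegral_of_nonneg_ae (ae_of_all _ fun p => by
    exact div_nonneg (mul_nonneg (dens_nonneg _ _) (abs_nonneg _)) (dens_nonneg _ _))
    (integrable_dens_ratio hF hdiff hbij hJ ρ ν hρ).1]
  exact ENNReal.toReal_mono (measure_ne_top _ _) (lintegral_dens_ratio_le hF hdiff hbij hJ ρ ν hρ)

variable {K : ℝ} (hK : ∀ x w, |Real.log (|jacDet F x w|)| ≤ K)

include hJ hK in
theorem integrable_log_jacDet :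
    Integrable (fun p : Vec n × Vec n => Real.log |jacDet F p.1 p.2|) (ρ.prod ν) :=
  Integrable.of_bound (Real.measurable_log.comp hJ).aestronglyMeasurable K
    (ae_of_all _ fun p => hK p.1 p.2)

-- By `log_dens_push_le`, the positive part of the log density at the image point is at most that of
-- `ρ` plus `K` plus the integrable ratio.
include hF hdiff hbij hne hJ hρ hK in
theorem LowerFinite.push (h : LowerFinite ρ) :
    LowerFinite ((ρ.prod ν).map (Function.uncurry F)) := by
  have hac := absolutelyContinuous_push hF hdiff hbij hne ρ ν hρ
  rw [lowerFinite_iff hac]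
  have hm : Measurable fun y =>
      max 0 (Real.log (dens ((ρ.prod ν).map (Function.uncurry F)) y)) :=
    measurable_const.max (Real.measurable_log.comp (measurable_dens _))
  rw [integrable_map_measure hm.aestronglyMeasurable hF.aemeasurable]
  have h1 := ((lowerFinite_iff hρ).1 h).comp_fst ν
  refine Integrable.mono' ((h1.add (integrable_const K)).add
    (integrable_dens_ratio hF hdiff hbij hJ ρ ν hρ)) (hm.comp hF).aestronglyMeasurable ?_
  filter_upwards [log_dens_push_le hF hdiff hbij hne ρ ν hρ] with p hp
  have h2 := neg_abs_le (Real.log (|jacDet F p.1 p.2|))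
  have h3 := hK p.1 p.2
  have h4 := div_nonneg (mul_nonneg (dens_nonneg ((ρ.prod ν).map (Function.uncurry F))
    (F p.1 p.2)) (abs_nonneg (jacDet F p.1 p.2))) (dens_nonneg ρ p.1)
  have h5 := le_max_left 0 (Real.log (dens ρ p.1))
  have h6 := le_max_right 0 (Real.log (dens ρ p.1))
  have h7 := abs_nonneg (Real.log (|jacDet F p.1 p.2|))
  simp only [Function.comp_apply, Function.uncurry, Pi.add_apply]
  rw [Real.norm_of_nonneg (le_max_left _ _)]
  exact max_le (by linarith) (by linarith)

-- This is `h(F(X, W)) ≥ h(F(X, W) | W) = h(X) + E log |J|`. Integrating `log_dens_push_le` bounds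
-- the difference by the integral of the ratio minus the mass of `ρ`, which is at most `0`. The same
-- bound, with the positive part from above, makes `log (dens ρ)` integrable.
include hF hdiff hbij hne hJ hρ hK in
theorem push_entropy (h : LowerFinite ρ)
    (hint : Integrable (densLog ((ρ.prod ν).map (Function.uncurry F)))) :
    Integrable (densLog ρ) ∧
      negEnt ((ρ.prod ν).map (Function.uncurry F)) ≤
        negEnt ρ - ∫ x, ∫ w, Real.log |jacDet F x w| ∂ν ∂ρ := by
  have hac := absolutelyContinuous_push hF hdiff hbij hne ρ ν hρ
  have hlog : Measurable fun y => Real.log (dens ((ρ.prod ν).map (Function.uncurry F)) y) :=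
    Real.measurable_log.comp (measurable_dens _)
  have hint' := (integrable_densLog_iff hac).1 hint
  rw [integrable_map_measure hlog.aestronglyMeasurable hF.aemeasurable] at hint'
  have hr := integrable_dens_ratio hF hdiff hbij hJ ρ ν hρ
  have hj := integrable_log_jacDet hJ ρ ν hK
  have hlower := (hint'.add hj).sub (hr.sub (integrable_const 1))
  have hle := log_dens_push_le hF hdiff hbij hne ρ ν hρ
  have hfst : Integrable (fun p : Vec n × Vec n => Real.log (dens ρ p.1)) (ρ.prod ν) := by
    refine integrable_of_le_of_le
      ((Real.measurable_log.comp ((measurable_dens ρ).comp measurable_fst)).aestronglyMeasurable)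
      ?_ (ae_of_all _ fun p => le_max_right 0 _) hlower (((lowerFinite_iff hρ).1 h).comp_fst ν)
    filter_upwards [hle] with p hp
    simp only [Function.comp_apply, Function.uncurry, Pi.add_apply, Pi.sub_apply]
    linarith
  refine ⟨(integrable_densLog_iff hρ).2 (hfst.of_comp_fst (IsProbabilityMeasure.ne_zero ν)), ?_⟩
  have h1 := integral_mono_ae ((hint'.add hj).sub hfst) (hr.sub (integrable_const 1)) hle
  have h2 : ∫ p : Vec n × Vec n, Real.log (dens ρ p.1) ∂(ρ.prod ν) = negEnt ρ := by
    rw [negEnt_eq hρ, integral_fun_fst (fun x => Real.log (dens ρ x))]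
    simp
  rw [integral_sub' hr (integrable_const 1), integral_sub' (hint'.add hj) hfst,
    integral_add' hint' hj, h2, integral_prod _ hj] at h1
  have h3 := integral_dens_ratio_le hF hdiff hbij hJ ρ ν hρ
  have h4 : ∫ _ : Vec n × Vec n, (1 : ℝ) ∂(ρ.prod ν) = ρ.real Set.univ := by
    rw [integral_const, smul_eq_mul, mul_one, measureReal_def, measureReal_def,
      ← Set.univ_prod_univ, Measure.prod_prod, measure_univ (μ := ν), mul_one]
  rw [negEnt_eq hac, integral_map hF.aemeasurable hlog.aestronglyMeasurable]
  simp only [Function.comp_def] at h1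
  linarith

end Pushforward

/-! ### Measurability of the Jacobian determinant -/

theorem measurable_jacDet {N : ℕ} {f : Vec N → Vec N → Vec N}
    (hf : Measurable (Function.uncurry f)) (hdiff : ∀ w, Differentiable ℝ fun x => f x w) :
    Measurable fun p : Vec N × Vec N => jacDet f p.1 p.2 := by
  let b := EuclideanSpace.basisFun (Fin N) ℝ
  have hdir : ∀ v : Vec N, Measurable fun p : Vec N × Vec N =>
      fderiv ℝ (fun y => f y p.2) p.1 v := by
    intro v
    -- As `f` is only measurable in `w`, each directional derivative is obtained as a limit of
    -- jointly measurable difference quotients with step `1 / k`; the determinant is a polynomial in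
    -- these.
    refine measurable_of_tendsto_metrizable
      (f := fun (k : ℕ) (p : Vec N × Vec N) =>
        (k : ℝ) • (f (p.1 + (k : ℝ)⁻¹ • v) p.2 - f p.1 p.2)) (fun k => ?_) ?_
    · have h1 : Measurable fun p : Vec N × Vec N => f (p.1 + (k : ℝ)⁻¹ • v) p.2 :=
        hf.comp ((measurable_fst.add_const _).prodMk measurable_snd)
      exact Measurable.const_smul (h1.sub hf) (k : ℝ)
    · rw [tendsto_pi_nhds]
      intro p
      exact (((hdiff p.2) p.1).hasFDerivAt.lim_real v).comp tendsto_natCast_atTop_atTop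
  have hdet : ∀ p : Vec N × Vec N, jacDet f p.1 p.2 =
      (Matrix.of fun i j => (fderiv ℝ (fun y => f y p.2) p.1 (b j)) i).det := by
    intro p
    rw [jacDet, ContinuousLinearMap.det, ← LinearMap.det_toMatrix b.toBasis]
    congr 1
    ext i j
    simp [LinearMap.toMatrix_apply, b]
  simp only [hdet, Matrix.det_apply]
  refine Finset.measurable_sum _ fun σ _ => Measurable.const_smul ?_ _
  refine Finset.measurable_prod _ fun i _ => ?_
  exact (EuclideanSpace.proj (𝕜 := ℝ) _).continuous.measurable.comp (hdir _)

/-! ### Independence of the present noise from the past -/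

section Independence

variable {Ω : Type*} [MeasurableSpace Ω] {P : Measure Ω}

/-- Both hypotheses together say that the law of the triple is the product of its three marginals,
which may be bracketed either way. -/
theorem indepFun_prodMk_left [IsProbabilityMeasure P] {α β γ : Type*} [MeasurableSpace α]
    [MeasurableSpace β] [MeasurableSpace γ] {X : Ω → α} {Y : Ω → β} {Z : Ω → γ}
    (hX : Measurable X) (hY : Measurable Y) (hZ : Measurable Z)
    (h : IndepFun X (fun ω => (Y ω, Z ω)) P) (hYZ : IndepFun Y Z P) :
    IndepFun (fun ω => (X ω, Y ω)) Z P := by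
  have hXY : IndepFun X Y P := h.comp measurable_id measurable_fst
  rw [indepFun_iff_map_prod_eq_prod_map_map (hX.prodMk hY).aemeasurable hZ.aemeasurable]
  rw [indepFun_iff_map_prod_eq_prod_map_map hX.aemeasurable (hY.prodMk hZ).aemeasurable] at h
  rw [indepFun_iff_map_prod_eq_prod_map_map hY.aemeasurable hZ.aemeasurable] at hYZ
  rw [indepFun_iff_map_prod_eq_prod_map_map hX.aemeasurable hY.aemeasurable] at hXY
  have := Measure.isProbabilityMeasure_map (μ := P) hX.aemeasurable
  have := Measure.isProbabilityMeasure_map (μ := P) hY.aemeasurable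
  have := Measure.isProbabilityMeasure_map (μ := P) hZ.aemeasurable
  apply MeasurableEquiv.prodAssoc.map_measurableEquiv_injective
  rw [hXY, Measure.prodAssoc_prod, ← hYZ, ← h,
    Measure.map_map MeasurableEquiv.prodAssoc.measurable ((hX.prodMk hY).prodMk hZ)]
  rfl

theorem comap_pi_le {Ω ι E : Type*} [MeasurableSpace E] {m : MeasurableSpace Ω} {v : Ω → ι → E}
    (h : ∀ r, MeasurableSpace.comap (fun ω => v ω r) inferInstance ≤ m) :
    MeasurableSpace.comap v inferInstance ≤ m :=
  measurable_iff_comap_le.1 (measurable_pi_iff.2 fun r => measurable_iff_comap_le.2 (h r))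

theorem iIndepFun.indepFun_tail {E : Type*} [MeasurableSpace E] {w : ℕ → Ω → E}
    (hw : iIndepFun w P) (hmeas : ∀ t, Measurable (w t)) (t : ℕ) :
    IndepFun (w t) (fun ω r => w (t + 1 + r) ω) P := by
  have h := indep_iSup_of_disjoint (fun i => (hmeas i).comap_le) hw.iIndep
    (S := {t}) (T := {r | t < r}) (by simp)
  rw [IndepFun_iff_Indep]
  refine indep_of_indep_of_le_left (indep_of_indep_of_le_right h ?_) ?_
  · refine comap_pi_le fun r => ?_
    exact le_iSup₂_of_le (f := fun i (_ : i ∈ {r | t < r}) => MeasurableSpace.comap (w i) _)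
      (t + 1 + r) (by simp only [Set.mem_ofPred_eq]; omega) le_rfl
  · exact le_iSup₂_of_le (f := fun i (_ : i ∈ ({t} : Set ℕ)) => MeasurableSpace.comap (w i) _)
      t rfl le_rfl

/-- A finite-valued output whose conditional law is a function of `U` given more information
inherits the independence of `U` from `V`. -/
theorem IndepFun.prodMk_of_output [IsProbabilityMeasure P] {α β B : Type*} [MeasurableSpace α]
    [MeasurableSpace β] [Fintype B] [MeasurableSpace B] [MeasurableSingletonClass B] {U : Ω → α}
    {V : Ω → β} {Y : Ω → B} (hU : Measurable U) (hV : Measurable V) (hY : Measurable Y)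
    (h : IndepFun U V P) {k : B → α → ℝ} (hk : ∀ y, Measurable (k y))
    (hker : ∀ y S T, MeasurableSet S → MeasurableSet T →
      P.real ((U ⁻¹' S ∩ V ⁻¹' T) ∩ Y ⁻¹' {y}) = ∫ ω in U ⁻¹' S ∩ V ⁻¹' T, k y (U ω) ∂P) :
    IndepFun (fun ω => (U ω, Y ω)) V P := by
  rw [indepFun_iff_measure_inter_preimage_eq_mul]
  intro S T hS hT
  have key : ∀ y S, MeasurableSet S → P ((U ⁻¹' S ∩ V ⁻¹' T) ∩ Y ⁻¹' {y}) =
      P (U ⁻¹' S ∩ Y ⁻¹' {y}) * P (V ⁻¹' T) := by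
    intro y S hS
    have h1 := hker y S T hS hT
    -- The case `T = univ` identifies the integral of `k y (U ω)` over `U ⁻¹' S`; independence of
    -- `U` and `V` then factors the general case.
    have h2 := hker y S Set.univ hS MeasurableSet.univ
    rw [Set.preimage_univ, Set.inter_univ] at h2
    have h3 : ∫ ω in U ⁻¹' S ∩ V ⁻¹' T, k y (U ω) ∂P =
        (∫ ω in U ⁻¹' S, k y (U ω) ∂P) * P.real (V ⁻¹' T) := by
      rw [← integral_indicator ((hU hS).inter (hV hT)), ← integral_indicator (hU hS),
        ← integral_indicator_one (hV hT)]
      have hind : IndepFun (fun ω => S.indicator (k y) (U ω))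
          (fun ω => T.indicator (1 : β → ℝ) (V ω)) P :=
        h.comp ((hk y).indicator hS) (measurable_one.indicator hT)
      have h4 := hind.integral_fun_mul_eq_mul_integral
        (((hk y).indicator hS).comp hU).aestronglyMeasurable
        ((measurable_one.indicator hT).comp hV).aestronglyMeasurable
      refine Eq.trans ?_ (h4.trans ?_)
      · refine integral_congr_ae (ae_of_all _ fun ω => ?_)
        by_cases hs : U ω ∈ S <;> by_cases ht : V ω ∈ T <;> simp [hs, ht]
      · rfl
    rw [h3, ← h2] at h1
    rwa [measureReal_def, measureReal_def, measureReal_def, ← ENNReal.toReal_mul,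
      ENNReal.toReal_eq_toReal_iff' (measure_ne_top _ _)
        (ENNReal.mul_ne_top (measure_ne_top _ _) (measure_ne_top _ _))] at h1
  have hUY : MeasurableSet ((fun ω => (U ω, Y ω)) ⁻¹' S) := (hU.prodMk hY) hS
  have hsplit : ∀ G : Set Ω, MeasurableSet G → P G = ∑ y, P (G ∩ Y ⁻¹' {y}) := by
    intro G hG
    have := sum_measure_preimage_singleton (μ := P.restrict G) Finset.univ (f := Y)
      (fun y _ => hY (measurableSet_singleton y))
    simp only [Finset.coe_univ, Set.preimage_univ, Measure.restrict_apply_univ] at this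
    rw [← this]
    refine Finset.sum_congr rfl fun y _ => ?_
    rw [Measure.restrict_apply (hY (measurableSet_singleton y)), Set.inter_comm]
  rw [hsplit _ (hUY.inter (hV hT)), hsplit _ hUY, Finset.sum_mul]
  refine Finset.sum_congr rfl fun y _ => ?_
  have hS' : MeasurableSet {u | (u, y) ∈ S} := measurable_prodMk_right hS
  have e1 : (fun ω => (U ω, Y ω)) ⁻¹' S ∩ V ⁻¹' T ∩ Y ⁻¹' {y} =
      (U ⁻¹' {u | (u, y) ∈ S} ∩ V ⁻¹' T) ∩ Y ⁻¹' {y} := by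
    ext ω
    simp only [Set.mem_inter_iff, Set.mem_preimage, Set.mem_singleton_iff, Set.mem_ofPred_eq]
    constructor
    · rintro ⟨⟨a, b⟩, rfl⟩
      exact ⟨⟨a, b⟩, rfl⟩
    · rintro ⟨⟨a, b⟩, rfl⟩
      exact ⟨⟨a, b⟩, rfl⟩
  have e2 : (fun ω => (U ω, Y ω)) ⁻¹' S ∩ Y ⁻¹' {y} = U ⁻¹' {u | (u, y) ∈ S} ∩ Y ⁻¹' {y} := by
    ext ω
    simp only [Set.mem_inter_iff, Set.mem_preimage, Set.mem_singleton_iff, Set.mem_ofPred_eq]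
    constructor
    · rintro ⟨a, rfl⟩
      exact ⟨a, rfl⟩
    · rintro ⟨a, rfl⟩
      exact ⟨a, rfl⟩
  rw [e1, e2, key y _ hS']

/-- The measure `E ↦ P (S ∩ {X ∈ E})`. -/
noncomputable def lawOn {E : Type*} [MeasurableSpace E] (P : Measure Ω) (X : Ω → E) (S : Set Ω) :
    Measure E :=
  (P.restrict S).map X

instance [IsFiniteMeasure P] {E : Type*} [MeasurableSpace E] (X : Ω → E) (S : Set Ω) :
    IsFiniteMeasure (lawOn P X S) := by
  unfold lawOn
  infer_instance

theorem lawOn_apply {E : Type*} [MeasurableSpace E] {X : Ω → E} (hX : Measurable X) (S : Set Ω)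
    {D : Set E} (hD : MeasurableSet D) : lawOn P X S D = P (X ⁻¹' D ∩ S) := by
  rw [lawOn, Measure.map_apply hX hD, Measure.restrict_apply (hX hD)]

theorem lawOn_real_univ {E : Type*} [MeasurableSpace E] {X : Ω → E} (hX : Measurable X)
    (S : Set Ω) : (lawOn P X S).real Set.univ = P.real S := by
  rw [measureReal_def, lawOn_apply hX S MeasurableSet.univ, Set.preimage_univ, Set.univ_inter,
    measureReal_def]

theorem sum_lawOn {E ζ : Type*} [MeasurableSpace E] [Fintype ζ] {X : Ω → E} (hX : Measurable X)
    {Z : Ω → ζ} (hZ : ∀ z, MeasurableSet (Z ⁻¹' {z})) (S : Set Ω) :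
    ∑ z, lawOn P X (S ∩ Z ⁻¹' {z}) = lawOn P X S := by
  ext D hD
  rw [Measure.coe_finsetSum, Finset.sum_apply, lawOn_apply hX S hD]
  have := sum_measure_preimage_singleton (μ := P.restrict (X ⁻¹' D ∩ S)) Finset.univ (f := Z)
    (fun z _ => hZ z)
  simp only [Finset.coe_univ, Set.preimage_univ, Measure.restrict_apply_univ] at this
  rw [← this]
  refine Finset.sum_congr rfl fun z _ => ?_
  rw [lawOn_apply hX _ hD, Measure.restrict_apply (hZ z), ← Set.inter_assoc, Set.inter_comm]

end Independence

/-! ### Words and histories -/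

section Histories

theorem measurable_initSeg {S : Type*} [MeasurableSpace S] {n T : ℕ} (h : n ≤ T) :
    Measurable (initSeg h : (Fin T → S) → (Fin n → S)) :=
  measurable_pi_iff.2 fun _ => measurable_pi_apply _

theorem measurable_hist {Ω S : Type*} [MeasurableSpace Ω] [MeasurableSpace S] {y : ℕ → Ω → S}
    {n : ℕ} (h : ∀ t < n, Measurable (y t)) : Measurable (hist y n) :=
  measurable_pi_iff.2 fun i => h i i.2

theorem measurable_of_hist {Ω S : Type*} [MeasurableSpace Ω] [MeasurableSpace S] {y : ℕ → Ω → S}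
    {n : ℕ} (h : Measurable (hist y n)) {t : ℕ} (ht : t < n) : Measurable (y t) :=
  (measurable_pi_apply (⟨t, ht⟩ : Fin n)).comp h

theorem hist_succ_eq_snoc_iff {Ω S : Type*} (y : ℕ → Ω → S) (n : ℕ) (ω : Ω) (b : Fin n → S)
    (z : S) : hist y (n + 1) ω = (Fin.snoc b z : Fin (n + 1) → S) ↔
      hist y n ω = b ∧ y n ω = z := by
  constructor
  · intro h
    refine ⟨funext fun i => ?_, ?_⟩
    · have := congrFun h i.castSucc
      rwa [Fin.snoc_castSucc] at this
    · have := congrFun h (Fin.last n)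
      rwa [Fin.snoc_last] at this
  · rintro ⟨rfl, rfl⟩
    funext i
    refine Fin.lastCases ?_ (fun j => ?_) i
    · rw [Fin.snoc_last]
      rfl
    · rw [Fin.snoc_castSucc]
      rfl

theorem sum_snoc {S M : Type*} [Fintype S] [AddCommMonoid M] {n : ℕ} (g : (Fin (n + 1) → S) → M) :
    ∑ b, g b = ∑ b : Fin n → S, ∑ z, g (Fin.snoc b z) := by
  rw [← (Fin.snocEquiv fun _ : Fin (n + 1) => S).sum_comp g, Fintype.sum_prod_type, Finset.sum_comm]
  rfl

/-- The state is measurable with respect to the initial state, the noise and the past outputs. -/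
theorem measurable_state {Ω B : Type*} [MeasurableSpace Ω] [MeasurableSpace B] {N : ℕ}
    {f : Vec N → Vec N → Vec N} (hf : Measurable (Function.uncurry f))
    {c : (t : ℕ) → (Fin (t + 1) → B) → Vec N} (hc : ∀ t, Measurable (c t))
    {x w : ℕ → Ω → Vec N} {q' : ℕ → Ω → B}
    (hx : ∀ t ω, x (t + 1) ω = f (x t ω) (w t ω) + c t (hist q' (t + 1) ω))
    (h0 : Measurable (x 0)) (hw : ∀ t, Measurable (w t)) (t : ℕ)
    (hq : Measurable (hist q' t)) : Measurable (x t) := by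
  induction t with
  | zero => exact h0
  | succ t ih =>
    have h1 := ih (measurable_hist fun r hr => measurable_of_hist hq (hr.trans (Nat.lt_succ_self t)))
    have h2 : x (t + 1) = fun ω => f (x t ω) (w t ω) + c t (hist q' (t + 1) ω) := funext (hx t)
    rw [h2]
    exact (hf.comp (h1.prodMk (hw t))).add ((hc t).comp hq)

end Histories

/-! ### Independence and conditional laws in the closed loop -/

section ClosedLoop

variable {Ω : Type*} [mΩ : MeasurableSpace Ω] {P : Measure Ω} [IsProbabilityMeasure P]
  {A B : Type*} [Fintype A] [MeasurableSpace A] [MeasurableSingletonClass A]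
  [Fintype B] [MeasurableSpace B] [MeasurableSingletonClass B] {N s : ℕ}
  {f : Vec N → Vec N → Vec N} {Bm : Vec s →L[ℝ] Vec N} {ν : Measure (Vec N)}
  {W : Channel A B} {γ : Policy N s A B} {x w : ℕ → Ω → Vec N} {q : ℕ → Ω → A} {q' : ℕ → Ω → B}
  (hf : Measurable (Function.uncurry f))

/-- The channel inputs as a function of the states and the past outputs. -/
def inputsOf (γ : Policy N s A B) (t : ℕ) (u : (Fin (t + 1) → Vec N) × (Fin t → B)) :
    Fin (t + 1) → A :=
  fun i => γ.enc i (initSeg (Nat.succ_le_of_lt i.2) u.1) (initSeg (Nat.le_of_lt_succ i.2) u.2)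

omit [Fintype A] [MeasurableSingletonClass A] [Fintype B] [MeasurableSingletonClass B] in
theorem measurable_inputsOf (γ : Policy N s A B) (t : ℕ) : Measurable (inputsOf γ t) :=
  measurable_pi_iff.2 fun i => (γ.measurable_enc i).comp
    (((measurable_initSeg _).comp measurable_fst).prodMk
      ((measurable_initSeg _).comp measurable_snd))

namespace IsClosedLoop

variable (h : IsClosedLoop P f Bm ν W γ x w q q')

include h

omit [IsProbabilityMeasure P] [Fintype A] [MeasurableSingletonClass A]
  [MeasurableSingletonClass B] in
theorem hist_input_eq (t : ℕ) (ω : Ω) :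
    hist q (t + 1) ω = inputsOf γ t (hist x (t + 1) ω, hist q' t ω) :=
  funext fun i => h.input_eq i ω

omit [IsProbabilityMeasure P] [Fintype A] [MeasurableSingletonClass A]
  [MeasurableSingletonClass B] in
theorem measurable_hist_output (t : ℕ) : Measurable (hist q' t) :=
  measurable_hist fun r _ => h.measurable_output r

include hf

omit [IsProbabilityMeasure P] [Fintype A] [MeasurableSingletonClass A] in
theorem measurable_x (t : ℕ) : Measurable (x t) :=
  measurable_state hf (c := fun t b => Bm (γ.ctrl t b)) (fun _ => Measurable.of_discrete)
    h.state_eq h.measurable_init h.measurable_noise t (h.measurable_hist_output t)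

omit [IsProbabilityMeasure P] [Fintype A] [MeasurableSingletonClass A] in
theorem measurable_past (t : ℕ) :
    Measurable fun ω => ((hist x (t + 1) ω, hist q' t ω) : (Fin (t + 1) → Vec N) × (Fin t → B)) :=
  (measurable_hist fun r _ => h.measurable_x hf r).prodMk (h.measurable_hist_output t)

omit [IsProbabilityMeasure P] [Fintype A] [MeasurableSingletonClass A] in
theorem measurable_hist_input (t : ℕ) : Measurable (hist q t) := by
  refine measurable_hist fun r _ => ?_
  have h1 : Measurable (hist q (r + 1)) := by
    rw [funext (h.hist_input_eq r)]
    exact (measurable_inputsOf γ r).comp (h.measurable_past hf r)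
  exact measurable_of_hist h1 (Nat.lt_succ_self r)

omit [IsProbabilityMeasure P] [Fintype A] [MeasurableSingletonClass A] in
/-- The past `x_{[0,t]}, q'_{[0,t-1]}` is measurable with respect to
`q_{[0,t]}, q'_{[0,t-1]}, x_0, w`. -/
theorem past_comap_le (t : ℕ) :
    Measurable[MeasurableSpace.comap
      (fun ω => (hist q (t + 1) ω, hist q' t ω, x 0 ω, fun r => w r ω)) inferInstance]
      fun ω => ((hist x (t + 1) ω, hist q' t ω) : (Fin (t + 1) → Vec N) × (Fin t → B)) := by
  set Z := fun ω => (hist q (t + 1) ω, hist q' t ω, x 0 ω, fun r => w r ω)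
  have hst := h.state_eq
  clear h
  -- From here on measurability refers to this σ-algebra, and `measurable_state` is applied to it
  -- instead of the ambient one.
  let _ : MeasurableSpace Ω := MeasurableSpace.comap Z inferInstance
  have hZ : Measurable Z := comap_measurable Z
  have hq : Measurable (hist q' t) := (measurable_fst.comp measurable_snd).comp hZ
  have h0 : Measurable (x 0) :=
    (measurable_fst.comp (measurable_snd.comp measurable_snd)).comp hZ
  have hw : Measurable fun ω r => w r ω :=
    (measurable_snd.comp (measurable_snd.comp measurable_snd)).comp hZ
  refine Measurable.prodMk (measurable_hist fun r hr => ?_) hq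
  exact measurable_state hf (c := fun t b => Bm (γ.ctrl t b)) (fun _ => Measurable.of_discrete)
    hst h0 (fun t => (measurable_pi_apply t).comp hw) r
    (measurable_hist fun j hj => measurable_of_hist hq (by omega))

-- The Markov condition of Class A upgrades the channel law to conditioning on `x_0` and the whole
-- noise as well. Integrating over `S` gives the only form in which that condition is used below.
omit [MeasurableSingletonClass A] in
theorem measureReal_inter_output (hA : IsClassA P W (x 0) w q q') (t : ℕ) (y : B) {S : Set Ω}
    (hS : MeasurableSet[MeasurableSpace.comap
      (fun ω => (hist q (t + 1) ω, hist q' t ω, x 0 ω, fun r => w r ω)) inferInstance] S) :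
    P.real (S ∩ q' t ⁻¹' {y}) =
      ∫ ω in S, W.prob t (hist q (t + 1) ω) (hist q' t ω) y ∂P := by
  have hZ : Measurable fun ω => (hist q (t + 1) ω, hist q' t ω, x 0 ω, fun r => w r ω) :=
    (h.measurable_hist_input hf _).prodMk ((h.measurable_hist_output t).prodMk
      (h.measurable_init.prodMk (measurable_pi_iff.2 h.measurable_noise)))
  have hle := hZ.comap_le
  have hY := h.measurable_output t (measurableSet_singleton y)
  have h1 := setIntegral_condExp hle (μ := P)
    (f := (q' t ⁻¹' {y}).indicator fun _ => (1 : ℝ)) ((integrable_const 1).indicator hY) hS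
  have h2 : P⟦q' t ⁻¹' {y} | MeasurableSpace.comap
      (fun ω => (hist q (t + 1) ω, hist q' t ω, x 0 ω, fun r => w r ω)) inferInstance⟧
      =ᵐ[P] fun ω => W.prob t (hist q (t + 1) ω) (hist q' t ω) y :=
    (hA.markov t {y} (measurableSet_singleton y)).trans (h.output_law t y)
  rw [integral_congr_ae (ae_restrict_of_ae h2)] at h1
  rw [h1, setIntegral_indicator hY]
  simp

/-- The past, including the present output, is independent of the present and future noise. -/
theorem indepFun_past_succ (hA : IsClassA P W (x 0) w q q') (t : ℕ)
    (hU : IndepFun (fun ω => ((hist x (t + 1) ω, hist q' t ω) :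
      (Fin (t + 1) → Vec N) × (Fin t → B))) (fun ω r => w (t + r) ω) P) :
    IndepFun (fun ω => (((hist x (t + 1) ω, hist q' t ω) :
      (Fin (t + 1) → Vec N) × (Fin t → B)), q' t ω)) (fun ω r => w (t + r) ω) P := by
  have hV : Measurable fun ω r => w (t + r) ω :=
    measurable_pi_iff.2 fun r => h.measurable_noise (t + r)
  have hW : ∀ y, Measurable fun p : (Fin (t + 1) → A) × (Fin t → B) => W.prob t p.1 p.2 y :=
    fun y => Measurable.of_discrete
  refine IndepFun.prodMk_of_output (h.measurable_past hf t) hV (h.measurable_output t) hU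
    (k := fun y u => W.prob t (inputsOf γ t u) u.2 y)
    (fun y => (hW y).comp ((measurable_inputsOf γ t).prodMk measurable_snd)) ?_
  intro y S T hS hT
  rw [h.measureReal_inter_output hf hA t y]
  · simp only [h.hist_input_eq]
  · refine MeasurableSet.inter (h.past_comap_le hf t hS) ?_
    refine measurableSet_preimage ?_ hT
    let _ : MeasurableSpace Ω := MeasurableSpace.comap
      (fun ω => (hist q (t + 1) ω, hist q' t ω, x 0 ω, fun r => w r ω)) inferInstance
    have hw : Measurable fun ω r => w r ω :=
      (measurable_snd.comp (measurable_snd.comp measurable_snd)).comp (comap_measurable _)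
    exact measurable_pi_iff.2 fun r => (measurable_pi_apply (t + r)).comp hw

/-- The whole noise tail is kept so that the induction closes: `q'_t` is adjoined to the past, then
`w_t` is moved from the tail to the past, and `x_{t+1}` is a function of what the past now contains.
-/
theorem indepFun_past (hA : IsClassA P W (x 0) w q q') (t : ℕ) :
    IndepFun (fun ω => ((hist x (t + 1) ω, hist q' t ω) :
      (Fin (t + 1) → Vec N) × (Fin t → B))) (fun ω r => w (t + r) ω) P := by
  induction t with
  | zero =>
    have h1 := h.init_indep.comp (_mγ := inferInstance) (_mγ' := inferInstance) (φ := fun a : Vec N =>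
      ((fun _ => a, fun i => i.elim0) : (Fin 1 → Vec N) × (Fin 0 → B))) (ψ := id)
      ((measurable_pi_iff.2 fun _ => measurable_id).prodMk measurable_const) measurable_id
    convert h1 using 1
    · funext ω
      refine Prod.ext (funext fun i => ?_) (Subsingleton.elim _ _)
      have : i = 0 := Fin.fin_one_eq_zero i
      subst this
      rfl
    · funext ω r
      simp
  | succ t ih =>
    have h1 := h.indepFun_past_succ hf hA t ih
    have hX := (h.measurable_past hf t).prodMk (h.measurable_output t)
    have hV : ∀ t, Measurable fun ω r => w (t + r) ω :=
      fun t => measurable_pi_iff.2 fun r => h.measurable_noise (t + r)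
    have h2 : IndepFun (fun ω => (((hist x (t + 1) ω, hist q' t ω) :
        (Fin (t + 1) → Vec N) × (Fin t → B)), q' t ω))
        (fun ω => (w t ω, fun r => w (t + 1 + r) ω)) P := by
      have h3 := h1.comp (_mγ := inferInstance) (_mγ' := inferInstance) (φ := id) (ψ := fun v : ℕ → Vec N => (v 0, fun r => v (1 + r)))
        measurable_id ((measurable_pi_apply 0).prodMk
          (measurable_pi_iff.2 fun r => measurable_pi_apply (1 + r)))
      convert h3 using 1
      · rfl
      · funext ω
        simp [add_assoc]
    have h3 := indepFun_prodMk_left hX (h.measurable_noise t) (hV (t + 1)) h2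
      (iIndepFun.indepFun_tail h.noise_indep h.measurable_noise t)
    rw [IndepFun_iff_Indep] at h3 ⊢
    refine indep_of_indep_of_le_left h3 ?_
    rw [← measurable_iff_comap_le]
    have hst := h.state_eq t
    clear h1 h2 h3 hX hV ih hA h
    set Z := fun ω => ((((hist x (t + 1) ω, hist q' t ω) :
        (Fin (t + 1) → Vec N) × (Fin t → B)), q' t ω), w t ω)
    let _ : MeasurableSpace Ω := MeasurableSpace.comap Z inferInstance
    have hZ : Measurable Z := comap_measurable Z
    have z1 : Measurable (hist x (t + 1)) :=
      (measurable_fst.comp (measurable_fst.comp measurable_fst)).comp hZ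
    have z2 : Measurable (hist q' t) :=
      (measurable_snd.comp (measurable_fst.comp measurable_fst)).comp hZ
    have z3 : Measurable (q' t) := (measurable_snd.comp measurable_fst).comp hZ
    have z4 : Measurable (w t) := measurable_snd.comp hZ
    have z5 : Measurable (hist q' (t + 1)) := measurable_hist fun r hr => by
      rcases (Nat.lt_succ_iff_lt_or_eq.1 hr) with hr | rfl
      · exact measurable_of_hist z2 hr
      · exact z3
    refine Measurable.prodMk (measurable_hist fun r hr => ?_) z5
    rcases (Nat.lt_succ_iff_lt_or_eq.1 hr) with hr | rfl
    · exact measurable_of_hist z1 hr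
    · rw [funext hst]
      have hc : Measurable fun b => Bm (γ.ctrl t b) := Measurable.of_discrete
      exact (hf.comp ((measurable_of_hist z1 (Nat.lt_succ_self t)).prodMk z4)).add (hc.comp z5)

/-- The output at time `t` must be included because the control `u_t` depends on it. -/
theorem indepFun_state_output_noise (hA : IsClassA P W (x 0) w q q') (t : ℕ) :
    IndepFun (fun ω => (x t ω, hist q' (t + 1) ω)) (w t) P := by
  have h1 := h.indepFun_past_succ hf hA t (h.indepFun_past hf hA t)
  have h2 := h1.comp (_mγ := inferInstance) (_mγ' := inferInstance) (φ := id) (ψ := fun v : ℕ → Vec N => v 0) measurable_id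
    (measurable_pi_apply 0)
  have h3 : (fun v : ℕ → Vec N => v 0) ∘ (fun ω r => w (t + r) ω) = w t := by
    funext ω
    simp
  rw [h3, IndepFun_iff_Indep] at h2
  rw [IndepFun_iff_Indep]
  refine indep_of_indep_of_le_left h2 ?_
  rw [← measurable_iff_comap_le]
  set Z := id ∘ fun ω => (((hist x (t + 1) ω, hist q' t ω) :
    (Fin (t + 1) → Vec N) × (Fin t → B)), q' t ω)
  let _ : MeasurableSpace Ω := MeasurableSpace.comap Z inferInstance
  have hZ : Measurable Z := comap_measurable Z
  have z1 : Measurable (hist x (t + 1)) := (measurable_fst.comp measurable_fst).comp hZ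
  have z2 : Measurable (hist q' t) := (measurable_snd.comp measurable_fst).comp hZ
  refine (measurable_of_hist z1 (Nat.lt_succ_self t)).prodMk (measurable_hist fun r hr => ?_)
  rcases (Nat.lt_succ_iff_lt_or_eq.1 hr) with hr | rfl
  · exact measurable_of_hist z2 hr
  · exact measurable_snd.comp hZ

/-- The law of the next state on an output word is a pushforward of a product measure. -/
theorem lawOn_succ (hA : IsClassA P W (x 0) w q q') (t : ℕ) (b : Fin (t + 1) → B) :
    lawOn P (x (t + 1)) (hist q' (t + 1) ⁻¹' {b}) =
      ((lawOn P (x t) (hist q' (t + 1) ⁻¹' {b})).prod ν).map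
        (Function.uncurry fun a v => f a v + Bm (γ.ctrl t b)) := by
  have hb := h.measurable_hist_output (t + 1) (measurableSet_singleton b)
  have hx := h.measurable_x hf t
  have hw := h.measurable_noise t
  have hν : IsProbabilityMeasure ν := by
    rw [← h.noise_law t]
    exact Measure.isProbabilityMeasure_map hw.aemeasurable
  have hprod : (lawOn P (x t) (hist q' (t + 1) ⁻¹' {b})).prod ν =
      (P.restrict (hist q' (t + 1) ⁻¹' {b})).map fun ω => (x t ω, w t ω) := by
    refine Measure.prod_eq fun S T hS hT => ?_
    have h1 := indepFun_iff_measure_inter_preimage_eq_mul.1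
      (h.indepFun_state_output_noise hf hA t) (S ×ˢ {b}) T
      (hS.prod (measurableSet_singleton b)) hT
    rw [Measure.map_apply (hx.prodMk hw) (hS.prod hT),
      Measure.restrict_apply ((hx.prodMk hw) (hS.prod hT)), lawOn_apply hx _ hS,
      ← h.noise_law t, Measure.map_apply hw hT]
    have e1 : (fun ω => (x t ω, hist q' (t + 1) ω)) ⁻¹' S ×ˢ {b} =
        x t ⁻¹' S ∩ hist q' (t + 1) ⁻¹' {b} := rfl
    rw [← e1, ← h1]
    congr 1
    ext ω
    simp only [Set.mem_inter_iff, Set.mem_preimage, Set.mem_prod, Set.mem_singleton_iff]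
    tauto
  have hF : Measurable (Function.uncurry fun a v => f a v + Bm (γ.ctrl t b)) :=
    hf.add measurable_const
  rw [hprod, Measure.map_map hF (hx.prodMk hw), lawOn]
  refine Measure.map_congr ?_
  filter_upwards [ae_restrict_mem hb] with ω hω
  have hω' : hist q' (t + 1) ω = b := hω
  rw [h.state_eq t ω, hω']
  rfl

/-- The law of the state on an extended output word is a mixture over the input words. -/
theorem lawOn_snoc (hA : IsClassA P W (x 0) w q q') (t : ℕ) (b : Fin t → B) (y : B) :
    lawOn P (x t) (hist q' (t + 1) ⁻¹' {(Fin.snoc b y : Fin (t + 1) → B)}) =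
      ∑ a, (W.prob t a b y).toNNReal •
        lawOn P (x t) (hist q' t ⁻¹' {b} ∩ hist q (t + 1) ⁻¹' {a}) := by
  have hx := h.measurable_x hf t
  have hqm := fun a => h.measurable_hist_input hf (t + 1) (measurableSet_singleton a)
  rw [← sum_lawOn hx hqm]
  refine Finset.sum_congr rfl fun a _ => ?_
  ext D hD
  rw [Measure.smul_apply, lawOn_apply hx _ hD, lawOn_apply hx _ hD]
  set S := x t ⁻¹' D ∩ (hist q' t ⁻¹' {b} ∩ hist q (t + 1) ⁻¹' {a}) with hS
  have e1 : x t ⁻¹' D ∩ (hist q' (t + 1) ⁻¹' {(Fin.snoc b y : Fin (t + 1) → B)} ∩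
      hist q (t + 1) ⁻¹' {a}) = S ∩ q' t ⁻¹' {y} := by
    ext ω
    simp only [hS, Set.mem_inter_iff, Set.mem_preimage, Set.mem_singleton_iff,
      hist_succ_eq_snoc_iff]
    tauto
  have hSm : MeasurableSet S := (hx hD).inter
    ((h.measurable_hist_output t (measurableSet_singleton b)).inter (hqm a))
  have h1 := h.measureReal_inter_output hf hA t y (S := S) (by
    refine MeasurableSet.inter ?_ (MeasurableSet.inter ?_ ?_)
    · have := h.past_comap_le hf t
      exact ((measurable_pi_apply (Fin.last t)).comp (measurable_fst.comp this)) hD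
    · exact ((measurable_fst.comp measurable_snd).comp (comap_measurable _))
        (measurableSet_singleton b)
    · exact (measurable_fst.comp (comap_measurable _)) (measurableSet_singleton a))
  -- On `S` both words are fixed, so the channel probability is constant.
  have h2 : ∫ ω in S, W.prob t (hist q (t + 1) ω) (hist q' t ω) y ∂P =
      W.prob t a b y * P.real S := by
    rw [setIntegral_congr_fun (g := fun _ => W.prob t a b y) hSm, setIntegral_const, smul_eq_mul,
      mul_comm]
    rintro ω ⟨-, h1, h2⟩
    have h1' : hist q' t ω = b := h1
    have h2' : hist q (t + 1) ω = a := h2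
    simp only [h1', h2']
  rw [e1, ← ENNReal.toReal_eq_toReal_iff' (measure_ne_top _ _) (by
    rw [ENNReal.smul_def]
    exact ENNReal.mul_ne_top ENNReal.coe_ne_top (measure_ne_top _ _)), ENNReal.toReal_smul,
    NNReal.smul_def, smul_eq_mul, Real.coe_toNNReal _ (W.prob_nonneg t a b y)]
  exact h1.trans h2

end IsClosedLoop

end ClosedLoop

/-! ### The extended-real differential entropy -/

section DiffEntropy

variable {n : ℕ} {μ : Measure (Vec n)}

theorem diffEntropy_of_ac (h : μ ≪ volume) :
    diffEntropy μ = ((∫⁻ x, ENNReal.ofReal (-(densLog μ x / Real.log 2)) : ENNReal) : EReal) -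
      ((∫⁻ x, ENNReal.ofReal (densLog μ x / Real.log 2) : ENNReal) : EReal) := by
  rw [diffEntropy, if_pos h]
  simp only [densLog, dens, Real.logb, mul_div_assoc]

theorem lintegral_pos_part_ne_top_iff :
    ∫⁻ x, ENNReal.ofReal (densLog μ x / Real.log 2) ≠ ⊤ ↔ LowerFinite μ := by
  have hl : 0 < Real.log 2 := Real.log_pos one_lt_two
  have h1 : ∫⁻ x, ENNReal.ofReal (densLog μ x / Real.log 2) =
      ENNReal.ofReal (Real.log 2)⁻¹ * ∫⁻ x, ENNReal.ofReal (max 0 (densLog μ x)) := by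
    rw [← lintegral_const_mul _ (measurable_const.max (measurable_densLog μ)).ennreal_ofReal]
    refine lintegral_congr fun x => ?_
    rw [div_eq_inv_mul, ENNReal.ofReal_mul (inv_pos.2 hl).le, max_comm, ENNReal.ofReal_max,
      ENNReal.ofReal_zero, max_eq_left zero_le]
  have h2 : LowerFinite μ ↔ ∫⁻ x, ENNReal.ofReal (max 0 (densLog μ x)) < ⊤ := by
    have h0 : 0 ≤ᵐ[volume] fun x => max 0 (densLog μ x) := ae_of_all _ fun x => le_max_left _ _
    rw [← hasFiniteIntegral_iff_ofReal h0]
    exact ⟨fun h => h.2,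
      fun h => ⟨(measurable_const.max (measurable_densLog μ)).aestronglyMeasurable, h⟩⟩
  rw [h1, h2, lt_top_iff_ne_top]
  refine not_congr ⟨fun h => ?_, fun h => ?_⟩
  · by_contra h'
    exact ENNReal.mul_ne_top ENNReal.ofReal_ne_top h' h
  · rw [h]
    exact ENNReal.mul_top (ENNReal.ofReal_pos.2 (inv_pos.2 hl)).ne'

theorem integrable_densLog_of_lintegral_neg (h : LowerFinite μ)
    (hneg : ∫⁻ x, ENNReal.ofReal (-(densLog μ x / Real.log 2)) ≠ ⊤) :
    Integrable (densLog μ) := by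
  have hl : 0 < Real.log 2 := Real.log_pos one_lt_two
  have hm : Measurable fun x => max 0 (-(densLog μ x / Real.log 2)) :=
    measurable_const.max ((measurable_densLog μ).div_const _).neg
  have h1 : Integrable fun x => max 0 (-(densLog μ x / Real.log 2)) := by
    refine ⟨hm.aestronglyMeasurable, ?_⟩
    have h0 : 0 ≤ᵐ[volume] fun x => max 0 (-(densLog μ x / Real.log 2)) :=
      ae_of_all _ fun x => le_max_left _ _
    rw [hasFiniteIntegral_iff_ofReal h0, lt_top_iff_ne_top]
    convert hneg using 3 with x
    rw [max_comm, ENNReal.ofReal_max, ENNReal.ofReal_zero, max_eq_left zero_le]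
  refine integrable_of_le_of_le (measurable_densLog μ).aestronglyMeasurable
    (ae_of_all _ fun x => ?_) (ae_of_all _ fun x => le_max_right 0 _)
    (h1.const_mul (-Real.log 2)) h
  have h2 := le_max_right 0 (-(densLog μ x / Real.log 2))
  have h3 := mul_le_mul_of_nonneg_left h2 hl.le
  have h4 : Real.log 2 * -(densLog μ x / Real.log 2) = -densLog μ x := by field_simp
  simp only [neg_mul]
  linarith

/-- Once the subtracted integral is finite, the only obstruction to a real value is an infinite
first integral, which would give `⊤`. -/
theorem diffEntropy_eq_of_ne_top (hac : μ ≪ volume) (h : LowerFinite μ)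
    (htop : diffEntropy μ ≠ ⊤) :
    Integrable (densLog μ) ∧ diffEntropy μ = ((-negEnt μ / Real.log 2 : ℝ) : EReal) := by
  have hpos := lintegral_pos_part_ne_top_iff.2 h
  rw [diffEntropy_of_ac hac] at htop ⊢
  have hneg : ∫⁻ x, ENNReal.ofReal (-(densLog μ x / Real.log 2)) ≠ ⊤ := by
    intro h0
    refine htop ?_
    rw [h0, ← ENNReal.ofReal_toReal hpos, EReal.coe_ennreal_top, EReal.coe_ennreal_ofReal]
    exact EReal.top_sub_coe _
  have hint := integrable_densLog_of_lintegral_neg h hneg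
  refine ⟨hint, ?_⟩
  have h1 := integral_eq_lintegral_pos_part_sub_lintegral_neg_part (hint.div_const (Real.log 2))
  rw [integral_div] at h1
  rw [negEnt, neg_div, h1, neg_sub, EReal.coe_sub, EReal.coe_ennreal_toReal hneg |>.symm,
    EReal.coe_ennreal_toReal hpos |>.symm]

theorem HasFiniteDiffEntropy.lowerFinite (h : HasFiniteDiffEntropy μ) : LowerFinite μ := by
  rw [← lintegral_pos_part_ne_top_iff]
  intro h0
  refine h.2.2 ?_
  -- In `EReal` also `⊤ - ⊤ = ⊥`, so the first integral need not be examined.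
  rw [diffEntropy_of_ac h.1, h0, EReal.coe_ennreal_top, EReal.sub_top]

end DiffEntropy

/-! ### The chain of entropy inequalities in the closed loop -/

section Chain

variable {Ω : Type*} [mΩ : MeasurableSpace Ω] {P : Measure Ω} [IsProbabilityMeasure P]
  {A B : Type*} [Fintype A] [MeasurableSpace A] [MeasurableSingletonClass A]
  [Fintype B] [MeasurableSpace B] [MeasurableSingletonClass B] {N s : ℕ}
  {f : Vec N → Vec N → Vec N} {Bm : Vec s →L[ℝ] Vec N} {ν : Measure (Vec N)}
  {W : Channel A B} {γ : Policy N s A B} {x w : ℕ → Ω → Vec N} {q : ℕ → Ω → A} {q' : ℕ → Ω → B}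

omit [IsProbabilityMeasure P] in
theorem lawOn_ac_mono {E : Type*} [MeasurableSpace E] {X : Ω → E} (hX : Measurable X)
    {S S' : Set Ω} (h : S ⊆ S') : lawOn P X S ≪ lawOn P X S' :=
  (Measure.absolutelyContinuous_of_le (Measure.restrict_mono h le_rfl)).map hX

omit [IsProbabilityMeasure P] in
theorem lawOn_univ {E : Type*} [MeasurableSpace E] (X : Ω → E) :
    lawOn P X Set.univ = P.map X := by
  rw [lawOn, Measure.restrict_univ]

theorem jacDet_add_const (f : Vec N → Vec N → Vec N) (c y v : Vec N) :
    jacDet (fun a v => f a v + c) y v = jacDet f y v := by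
  rw [jacDet, jacDet, fderiv_add_const]

/-- The sum of the negative entropies of the laws of `x_t` on the output words of length `t`. -/
noncomputable def jointNegEnt (P : Measure Ω) (x : ℕ → Ω → Vec N) (q' : ℕ → Ω → B) (t : ℕ) : ℝ :=
  ∑ b, negEnt (lawOn P (x t) (hist q' t ⁻¹' {b}))

/-- The negative of the conditional entropy, in nats, of `q'_t` given
`q_{[0,t]}, q'_{[0,t-1]}`. -/
noncomputable def channelNegEnt (P : Measure Ω) (W : Channel A B) (q : ℕ → Ω → A)
    (q' : ℕ → Ω → B) (t : ℕ) : ℝ :=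
  ∑ b, ∑ a, P.real (hist q' t ⁻¹' {b} ∩ hist q (t + 1) ⁻¹' {a}) *
    ∑ y, W.prob t a b y * Real.log (W.prob t a b y)

/-- The mean of `ln |J(f(x_t, w_t))|`. -/
noncomputable def meanLogJac (P : Measure Ω) (f : Vec N → Vec N → Vec N) (ν : Measure (Vec N))
    (x : ℕ → Ω → Vec N) (t : ℕ) : ℝ :=
  ∫ y, ∫ v, Real.log |jacDet f y v| ∂ν ∂(P.map (x t))

namespace IsClosedLoop

variable (h : IsClosedLoop P f Bm ν W γ x w q q') (hf : Measurable (Function.uncurry f))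
  (hA : IsClassA P W (x 0) w q q') (hdiff : ∀ v, Differentiable ℝ fun y => f y v)
  (hbij : ∀ v, Function.Bijective fun y => f y v) (hne : ∀ y v, jacDet f y v ≠ 0)
  {K : ℝ} (hK : ∀ y v, |Real.log (|jacDet f y v|)| ≤ K)

include h

omit [Fintype A] [MeasurableSingletonClass A] [MeasurableSingletonClass B] in
theorem isProbabilityMeasure_noise : IsProbabilityMeasure ν := by
  rw [← h.noise_law 0]
  exact Measure.isProbabilityMeasure_map (h.measurable_noise 0).aemeasurable

include hf hA

theorem lowerFinite_snoc {t : ℕ} {b : Fin t → B}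
    (hlow : LowerFinite (lawOn P (x t) (hist q' t ⁻¹' {b}))) (y : B) :
    LowerFinite (lawOn P (x t) (hist q' (t + 1) ⁻¹' {(Fin.snoc b y : Fin (t + 1) → B)})) := by
  have hqm := fun a => h.measurable_hist_input hf (t + 1) (measurableSet_singleton a)
  rw [← sum_lawOn (h.measurable_x hf t) hqm] at hlow
  rw [h.lawOn_snoc hf hA t b y]
  exact hlow.mixture (V := fun a y => W.prob t a b y) (fun a y => W.prob_nonneg t a b y)
    (fun a => W.prob_sum t a b) _ y

theorem mixture_step {t : ℕ} {b : Fin t → B}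
    (hac : lawOn P (x t) (hist q' t ⁻¹' {b}) ≪ volume)
    (hlow : LowerFinite (lawOn P (x t) (hist q' t ⁻¹' {b})))
    (hint : ∀ y, Integrable (densLog
      (lawOn P (x t) (hist q' (t + 1) ⁻¹' {(Fin.snoc b y : Fin (t + 1) → B)})))) :
    Integrable (densLog (lawOn P (x t) (hist q' t ⁻¹' {b}))) ∧
      ∑ y, negEnt (lawOn P (x t) (hist q' (t + 1) ⁻¹' {(Fin.snoc b y : Fin (t + 1) → B)})) ≤
        negEnt (lawOn P (x t) (hist q' t ⁻¹' {b})) +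
          ∑ a, P.real (hist q' t ⁻¹' {b} ∩ hist q (t + 1) ⁻¹' {a}) *
            ∑ y, W.prob t a b y * Real.log (W.prob t a b y) := by
  have hx := h.measurable_x hf t
  have hqm := fun a => h.measurable_hist_input hf (t + 1) (measurableSet_singleton a)
  simp only [h.lawOn_snoc hf hA t b] at hint ⊢
  have hlow' := hlow
  rw [← sum_lawOn hx hqm] at hlow' ⊢
  have h1 := integrable_densLog_of_mixture (V := fun a y => W.prob t a b y)
    (fun a y => W.prob_nonneg t a b y) (fun a => W.prob_sum t a b) _ hlow' hint
  refine ⟨h1, ?_⟩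
  have h2 := sum_negEnt_mixture_le (V := fun a y => W.prob t a b y)
    (fun a y => W.prob_nonneg t a b y) (fun a => W.prob_sum t a b) _
    (fun a => (lawOn_ac_mono hx Set.inter_subset_left).trans hac) hint h1
  simpa only [lawOn_real_univ hx] using h2

include hdiff hbij hne

/-- The induction splits the law into output words, because only on a fixed word is the control a
constant translation. -/
theorem lawOn_ac (h0 : P.map (x 0) ≪ volume) (t : ℕ) (S : Set Ω) :
    lawOn P (x t) S ≪ volume := by
  have hν := h.isProbabilityMeasure_noise
  have hx := h.measurable_x hf
  suffices hall : P.map (x t) ≪ volume by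
    rw [← lawOn_univ] at hall
    exact (lawOn_ac_mono (hx t) (Set.subset_univ S)).trans hall
  induction t with
  | zero => exact h0
  | succ t ih =>
    rw [← lawOn_univ, ← sum_lawOn (hx (t + 1))
      fun b => h.measurable_hist_output (t + 1) (measurableSet_singleton b)]
    refine Measure.AbsolutelyContinuous.mk fun D _ hD => ?_
    rw [Measure.coe_finsetSum, Finset.sum_apply]
    refine Finset.sum_eq_zero fun b _ => ?_
    rw [Set.univ_inter, h.lawOn_succ hf hA t b]
    refine absolutelyContinuous_push (hf.add measurable_const)
      (fun v => (hdiff v).add_const _)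
      (fun v => (Equiv.addRight (Bm (γ.ctrl t b))).bijective.comp (hbij v))
      (fun y v => by rw [jacDet_add_const]; exact hne y v) _ ν ?_ hD
    rw [← lawOn_univ] at ih
    exact (lawOn_ac_mono (hx t) (Set.subset_univ _)).trans ih

include hK

theorem lowerFinite_lawOn_succ {t : ℕ} {b : Fin (t + 1) → B}
    (hac : lawOn P (x t) (hist q' (t + 1) ⁻¹' {b}) ≪ volume)
    (hlow : LowerFinite (lawOn P (x t) (hist q' (t + 1) ⁻¹' {b}))) :
    LowerFinite (lawOn P (x (t + 1)) (hist q' (t + 1) ⁻¹' {b})) := by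
  have hν := h.isProbabilityMeasure_noise
  rw [h.lawOn_succ hf hA t b]
  refine LowerFinite.push (hf.add measurable_const) (fun v => (hdiff v).add_const _)
    (fun v => (Equiv.addRight (Bm (γ.ctrl t b))).bijective.comp (hbij v))
    (fun y v => by rw [jacDet_add_const]; exact hne y v) ?_ _ ν hac (K := K)
    (fun y v => by rw [jacDet_add_const]; exact hK y v) hlow
  simp only [jacDet_add_const]
  exact (measurable_jacDet hf hdiff).abs

theorem push_step {t : ℕ} {b : Fin (t + 1) → B}
    (hac : lawOn P (x t) (hist q' (t + 1) ⁻¹' {b}) ≪ volume)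
    (hlow : LowerFinite (lawOn P (x t) (hist q' (t + 1) ⁻¹' {b})))
    (hint : Integrable (densLog (lawOn P (x (t + 1)) (hist q' (t + 1) ⁻¹' {b})))) :
    Integrable (densLog (lawOn P (x t) (hist q' (t + 1) ⁻¹' {b}))) ∧
      negEnt (lawOn P (x (t + 1)) (hist q' (t + 1) ⁻¹' {b})) ≤
        negEnt (lawOn P (x t) (hist q' (t + 1) ⁻¹' {b})) -
          ∫ y, ∫ v, Real.log |jacDet f y v| ∂ν ∂(lawOn P (x t) (hist q' (t + 1) ⁻¹' {b})) := by
  have hν := h.isProbabilityMeasure_noise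
  rw [h.lawOn_succ hf hA t b] at hint ⊢
  have h1 := push_entropy (F := fun a v => f a v + Bm (γ.ctrl t b)) (hf.add measurable_const) (fun v => (hdiff v).add_const _)
    (fun v => (Equiv.addRight (Bm (γ.ctrl t b))).bijective.comp (hbij v))
    (fun y v => by rw [jacDet_add_const]; exact hne y v) (by
      simp only [jacDet_add_const]
      exact (measurable_jacDet hf hdiff).abs) _ ν hac (K := K)
    (fun y v => by rw [jacDet_add_const]; exact hK y v) hlow hint
  simpa only [jacDet_add_const] using h1

/-- The forward induction: each step first appends the last letter of the word (mixture), then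
applies the dynamics (pushforward). -/
theorem lowerFinite_lawOn (h0 : HasFiniteDiffEntropy (P.map (x 0))) (t : ℕ) (b : Fin t → B) :
    LowerFinite (lawOn P (x t) (hist q' t ⁻¹' {b})) := by
  induction t with
  | zero =>
    have : hist q' 0 ⁻¹' {b} = Set.univ :=
      Set.eq_univ_of_forall fun ω => Subsingleton.elim _ _
    rw [this, lawOn_univ]
    exact h0.lowerFinite
  | succ t ih =>
    refine h.lowerFinite_lawOn_succ hf hA hdiff hbij hne hK
      (h.lawOn_ac hf hA hdiff hbij hne h0.1 t _) ?_
    rw [← Fin.snoc_init_self b]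
    exact h.lowerFinite_snoc hf hA (ih _) _

/-- Integrability runs opposite to time: through the dynamics back to words of length `t + 1` at
state `x_t`, then through the mixture to words of length `t`. -/
theorem jointNegEnt_succ_le (h0 : HasFiniteDiffEntropy (P.map (x 0))) {t : ℕ}
    (hint : ∀ b : Fin (t + 1) → B,
      Integrable (densLog (lawOn P (x (t + 1)) (hist q' (t + 1) ⁻¹' {b})))) :
    (∀ b : Fin t → B, Integrable (densLog (lawOn P (x t) (hist q' t ⁻¹' {b})))) ∧
      jointNegEnt P x q' (t + 1) ≤
        jointNegEnt P x q' t + channelNegEnt P W q q' t - meanLogJac P f ν x t := by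
  have hν := h.isProbabilityMeasure_noise
  have hac := h.lawOn_ac hf hA hdiff hbij hne h0.1 t
  have hlow := h.lowerFinite_lawOn hf hA hdiff hbij hne hK h0 t
  have hpush := fun b : Fin (t + 1) → B => h.push_step hf hA hdiff hbij hne hK (hac _) (by
    rw [← Fin.snoc_init_self b]
    exact h.lowerFinite_snoc hf hA (hlow _) _) (hint b)
  have hmix := fun b : Fin t → B => h.mixture_step hf hA (hac _) (hlow b)
    fun y => (hpush (Fin.snoc b y)).1
  refine ⟨fun b => (hmix b).1, ?_⟩
  have hmean : meanLogJac P f ν x t = ∑ b : Fin (t + 1) → B,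
      ∫ y, ∫ v, Real.log |jacDet f y v| ∂ν ∂(lawOn P (x t) (hist q' (t + 1) ⁻¹' {b})) := by
    rw [meanLogJac, ← lawOn_univ, ← sum_lawOn (h.measurable_x hf t)
      fun b => h.measurable_hist_output (t + 1) (measurableSet_singleton b)]
    simp only [Set.univ_inter]
    rw [integral_finsetSum_measure]
    intro b _
    exact (integrable_log_jacDet (measurable_jacDet hf hdiff).abs _ ν hK).integral_prod_left
  rw [hmean, jointNegEnt, jointNegEnt, channelNegEnt, ← Finset.sum_add_distrib]
  have h1 := Finset.sum_le_sum fun b (_ : b ∈ Finset.univ) => (hpush b).2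
  have h2 := Finset.sum_le_sum fun b (_ : b ∈ Finset.univ) => (hmix b).2
  rw [Finset.sum_sub_distrib] at h1
  rw [← sum_snoc fun b : Fin (t + 1) → B =>
    negEnt (lawOn P (x t) (hist q' (t + 1) ⁻¹' {b}))] at h2
  linarith

theorem jointNegEnt_le (h0 : HasFiniteDiffEntropy (P.map (x 0))) (T : ℕ)
    (hint : ∀ b : Fin T → B, Integrable (densLog (lawOn P (x T) (hist q' T ⁻¹' {b})))) :
    jointNegEnt P x q' T ≤ negEnt (P.map (x 0)) +
      ∑ t ∈ Finset.range T, (channelNegEnt P W q q' t - meanLogJac P f ν x t) := by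
  induction T with
  | zero =>
    have : ∀ b : Fin 0 → B, hist q' 0 ⁻¹' {b} = Set.univ :=
      fun b => Set.eq_univ_of_forall fun ω => Subsingleton.elim _ _
    simp [jointNegEnt, this, lawOn_univ]
  | succ T ih =>
    have h1 := h.jointNegEnt_succ_le hf hA hdiff hbij hne hK h0 hint
    have h2 := ih h1.1
    rw [Finset.sum_range_succ]
    linarith [h1.2]

/-- The entropies of the state and of the outputs bound the entropy rate of the loop. -/
theorem entropy_inequality (h0 : HasFiniteDiffEntropy (P.map (x 0))) (T : ℕ)
    (htop : diffEntropy (P.map (x T)) ≠ ⊤) :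
    ∃ hT : ℝ, diffEntropy (P.map (x T)) = ((hT / Real.log 2 : ℝ) : EReal) ∧
      -hT + ∑ b, P.real (hist q' T ⁻¹' {b}) * Real.log (P.real (hist q' T ⁻¹' {b})) ≤
        negEnt (P.map (x 0)) +
          ∑ t ∈ Finset.range T, (channelNegEnt P W q q' t - meanLogJac P f ν x t) := by
  have hx := h.measurable_x hf T
  have hb := fun b => h.measurable_hist_output T (measurableSet_singleton b)
  have hsum : ∑ b, lawOn P (x T) (hist q' T ⁻¹' {b}) = P.map (x T) := by
    rw [← lawOn_univ, ← sum_lawOn hx hb]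
    simp only [Set.univ_inter]
  have hprob : IsProbabilityMeasure (∑ b, lawOn P (x T) (hist q' T ⁻¹' {b})) := by
    rw [hsum]
    exact Measure.isProbabilityMeasure_map hx.aemeasurable
  have hac := h.lawOn_ac hf hA hdiff hbij hne h0.1 T
  have hlow := h.lowerFinite_lawOn hf hA hdiff hbij hne hK h0 T
  -- The value `⊥` is excluded by the forward propagation and `⊤` by hypothesis, so `h(x_T)` is
  -- real. Integrability then passes to each output word and starts the backward induction.
  have h1 := diffEntropy_eq_of_ne_top (by rw [← lawOn_univ]; exact hac _)
    (by rw [← hsum]; exact LowerFinite.sum _ hlow) htop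
  refine ⟨_, h1.2, ?_⟩
  rw [neg_neg]
  have h2 := h1.1
  rw [← hsum] at h2
  have hint := integrable_densLog_of_sum _ hlow h2
  have h3 := negEnt_sum_le _ (fun b => hac _) h2 hint
  simp only [lawOn_real_univ hx] at h3
  rw [hsum] at h3
  exact h3.trans (h.jointNegEnt_le hf hA hdiff hbij hne hK h0 T hint)

end IsClosedLoop

end Chain

/-! ### Directed information in the closed loop -/

section FiniteInformation

/-- The entropy in bits of a finite-valued random variable. -/
noncomputable def rvEntropy {Ω S : Type*} [MeasurableSpace Ω] [Fintype S] (P : Measure Ω)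
    (Y : Ω → S) : ℝ :=
  -∑ s, P.real (Y ⁻¹' {s}) * Real.logb 2 (P.real (Y ⁻¹' {s}))

theorem continuous_finEntropy {Ω S : Type*} [Fintype Ω] [Fintype S] (X : Ω → S) :
    Continuous fun p : Ω → ℝ => finEntropy p X := by
  classical
  have h1 : Continuous fun u : ℝ => u * Real.logb 2 u := by
    simp only [Real.logb, ← mul_div_assoc]
    exact Real.continuous_mul_log.div_const _
  refine (continuous_finsetSum _ fun s _ => h1.comp ?_).neg
  refine continuous_finsetSum _ fun ω _ => ?_
  split_ifs
  · exact continuous_apply ω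
  · exact continuous_const

/-- A real supremum bounds its members only when they are bounded above. Here the rate is a
continuous function of the joint mass function, which ranges in a compact cube. -/
theorem bddAbove_directedInfo {A B : Type*} [Fintype A] [Fintype B] (W : Channel A B) (T : ℕ) :
    BddAbove (Set.range fun P : InputLaw A B => directedInfo W P T / T) := by
  have hcont : Continuous fun p : (Fin T → A) × (Fin T → B) → ℝ =>
      (∑ t : Fin T, finCondMutualInfo p (fun ab => ab.2 t)
        (fun ab => (initSeg t.2 ab.1 : Fin (t + 1) → A))
        (fun ab => (initSeg t.2.le ab.2 : Fin t → B))) / T := by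
    refine (continuous_finsetSum _ fun t _ => ?_).div_const _
    simp only [finCondMutualInfo, finCondEntropy]
    exact ((continuous_finEntropy _).sub (continuous_finEntropy _)).sub
      ((continuous_finEntropy _).sub (continuous_finEntropy _))
  have hK : IsCompact (Set.pi Set.univ
      fun _ : (Fin T → A) × (Fin T → B) => Set.Icc (0 : ℝ) 1) :=
    isCompact_univ_pi fun _ => isCompact_Icc
  refine (hK.bddAbove_image hcont.continuousOn).mono ?_
  rintro _ ⟨P, rfl⟩
  refine ⟨jointMass W P T, fun ab _ => ⟨?_, ?_⟩, rfl⟩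
  · exact Finset.prod_nonneg fun t _ => mul_nonneg (P.prob_nonneg _ _ _ _) (W.prob_nonneg _ _ _ _)
  · refine Finset.prod_le_one
      (fun t _ => mul_nonneg (P.prob_nonneg _ _ _ _) (W.prob_nonneg _ _ _ _)) fun t _ => ?_
    refine mul_le_one₀ ?_ (W.prob_nonneg _ _ _ _) ?_
    · rw [← P.prob_sum t (initSeg t.2.le ab.1) (initSeg t.2.le ab.2)]
      exact Finset.single_le_sum (f := fun z => P.prob t _ _ z)
        (fun z _ => P.prob_nonneg _ _ _ _) (Finset.mem_univ _)
    · rw [← W.prob_sum t (initSeg t.2 ab.1) (initSeg t.2.le ab.2)]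
      exact Finset.single_le_sum (f := fun z => W.prob t _ _ z)
        (fun z _ => W.prob_nonneg _ _ _ _) (Finset.mem_univ _)

variable {Ω : Type*} [MeasurableSpace Ω] {P : Measure Ω} [IsProbabilityMeasure P]

theorem massOf_law {R S : Type*} [Fintype R] {Y : Ω → R} (hY : ∀ r, MeasurableSet (Y ⁻¹' {r}))
    (X : R → S) (s : S) :
    massOf (fun r => P.real (Y ⁻¹' {r})) X s = P.real ((fun ω => X (Y ω)) ⁻¹' {s}) := by
  classical
  have h1 := sum_measure_preimage_singleton (μ := P) (Finset.univ.filter fun r => X r = s) (f := Y)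
    (fun r _ => hY r)
  have h2 : (fun ω => X (Y ω)) ⁻¹' {s} = Y ⁻¹' ↑(Finset.univ.filter fun r => X r = s) := by
    ext ω
    simp
  rw [measureReal_def, h2, ← h1, ENNReal.toReal_sum fun r _ => measure_ne_top _ _,
    Finset.sum_filter, massOf]
  refine Finset.sum_congr rfl fun r _ => ?_
  split_ifs <;> rfl

theorem finEntropy_law {R S : Type*} [Fintype R] [Fintype S] {Y : Ω → R}
    (hY : ∀ r, MeasurableSet (Y ⁻¹' {r})) (X : R → S) :
    finEntropy (fun r => P.real (Y ⁻¹' {r})) X = rvEntropy P fun ω => X (Y ω) := by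
  simp only [finEntropy, rvEntropy, massOf_law hY]

theorem sum_real_inter_preimage {S : Type*} [Fintype S] {Y : Ω → S}
    (hY : ∀ s, MeasurableSet (Y ⁻¹' {s})) (G : Set Ω) :
    ∑ s, P.real (G ∩ Y ⁻¹' {s}) = P.real G := by
  have h1 := sum_measure_preimage_singleton (μ := P.restrict G) Finset.univ (f := Y)
    (fun y _ => hY y)
  simp only [Finset.coe_univ, Set.preimage_univ, Measure.restrict_apply_univ] at h1
  rw [measureReal_def, ← h1, ENNReal.toReal_sum fun r _ => measure_ne_top _ _]
  refine Finset.sum_congr rfl fun s _ => ?_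
  rw [Measure.restrict_apply (hY s), Set.inter_comm, measureReal_def]

omit [IsProbabilityMeasure P] in
theorem rvEntropy_prodMk_hist {B : Type*} [Fintype B] (q' : ℕ → Ω → B) (t : ℕ) :
    rvEntropy P (fun ω => (q' t ω, hist q' t ω)) = rvEntropy P (hist q' (t + 1)) := by
  rw [rvEntropy, rvEntropy, sum_snoc, Fintype.sum_prod_type, Finset.sum_comm]
  have e : ∀ b y, (fun ω => (q' t ω, hist q' t ω)) ⁻¹' {(y, b)} =
      hist q' (t + 1) ⁻¹' {(Fin.snoc b y : Fin (t + 1) → B)} := by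
    intro b y
    ext ω
    simp only [Set.mem_preimage, Set.mem_singleton_iff, hist_succ_eq_snoc_iff, Prod.mk.injEq]
    tauto
  simp only [e]

theorem rvEntropy_hist_zero {B : Type*} [Fintype B] (q' : ℕ → Ω → B) :
    rvEntropy P (hist q' 0) = 0 := by
  have : ∀ b : Fin 0 → B, hist q' 0 ⁻¹' {b} = Set.univ :=
    fun b => Set.eq_univ_of_forall fun ω => Subsingleton.elim _ _
  simp [rvEntropy, this]

end FiniteInformation

/-! ### The input law induced by the loop -/

section InducedInput

variable {Ω : Type*} [mΩ : MeasurableSpace Ω] {P : Measure Ω} [IsProbabilityMeasure P]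
  {A B : Type*} [Fintype A] [MeasurableSpace A] [MeasurableSingletonClass A]
  [Fintype B] [MeasurableSpace B] [MeasurableSingletonClass B] {N s : ℕ}
  {f : Vec N → Vec N → Vec N} {Bm : Vec s →L[ℝ] Vec N} {ν : Measure (Vec N)}
  {W : Channel A B} {γ : Policy N s A B} {x w : ℕ → Ω → Vec N} {q : ℕ → Ω → A} {q' : ℕ → Ω → B}

/-- The probability of the words `a` of inputs and `b` of outputs. -/
noncomputable def wordProb (P : Measure Ω) (q : ℕ → Ω → A) (q' : ℕ → Ω → B) {m n : ℕ}
    (a : Fin m → A) (b : Fin n → B) : ℝ :=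
  P.real (hist q' n ⁻¹' {b} ∩ hist q m ⁻¹' {a})

open Classical in
/-- The conditional input distributions of the closed loop, with the value `δ_{a₀}` on words of
probability zero. -/
noncomputable def inducedInputLaw (P : Measure Ω) [IsProbabilityMeasure P] (a₀ : A)
    {q : ℕ → Ω → A} (hq : ∀ t, Measurable (q t)) (q' : ℕ → Ω → B) : InputLaw A B where
  prob t a b z :=
    if wordProb P q q' a b = 0 then (if z = a₀ then 1 else 0)
    else wordProb P q q' (Fin.snoc a z : Fin (t + 1) → A) b / wordProb P q q' a b
  prob_nonneg t a b z := by
    split_ifs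
    · exact zero_le_one
    · exact le_rfl
    · exact div_nonneg measureReal_nonneg measureReal_nonneg
  prob_sum t a b := by
    split_ifs with h
    · simp
    · rw [← Finset.sum_div, div_eq_one_iff_eq h, wordProb,
        ← sum_real_inter_preimage fun z => hq t (measurableSet_singleton z)]
      refine Finset.sum_congr rfl fun z _ => ?_
      rw [wordProb]
      congr 1
      ext ω
      simp only [Set.mem_inter_iff, Set.mem_preimage, Set.mem_singleton_iff,
        hist_succ_eq_snoc_iff]
      tauto

-- The choice of `a₀` is immaterial: if the shorter word has probability zero, so has its extension.
omit [Fintype B] [MeasurableSpace B] [MeasurableSingletonClass B] in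
theorem wordProb_mul_inducedInputLaw (a₀ : A) (hq : ∀ t, Measurable (q t)) {t : ℕ}
    (a : Fin t → A) (b : Fin t → B) (z : A) :
    wordProb P q q' a b * (inducedInputLaw P a₀ hq q').prob t a b z =
      wordProb P q q' (Fin.snoc a z : Fin (t + 1) → A) b := by
  simp only [inducedInputLaw]
  split_ifs with h h'
  all_goals try rw [mul_div_cancel₀ _ h]
  all_goals
    rw [h, zero_mul]
    refine (le_antisymm ?_ measureReal_nonneg).symm
    rw [← h]
    refine measureReal_mono (Set.inter_subset_inter_right _ fun ω hω => ?_)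
    exact ((hist_succ_eq_snoc_iff q t ω a z).1 hω).1

namespace IsClosedLoop

variable (h : IsClosedLoop P f Bm ν W γ x w q q') (hf : Measurable (Function.uncurry f))
  (hA : IsClassA P W (x 0) w q q')

include h hf hA

theorem wordProb_snoc {t : ℕ} (a : Fin (t + 1) → A) (b : Fin t → B) (y : B) :
    wordProb P q q' a (Fin.snoc b y : Fin (t + 1) → B) =
      wordProb P q q' a b * W.prob t a b y := by
  have hc := comap_measurable (m := inferInstance)
    fun ω => (hist q (t + 1) ω, hist q' t ω, x 0 ω, fun r => w r ω)
  have hb := h.measurable_hist_output t (measurableSet_singleton b)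
  have ha := h.measurable_hist_input hf (t + 1) (measurableSet_singleton a)
  have h1 := h.measureReal_inter_output hf hA t y
    (S := hist q' t ⁻¹' {b} ∩ hist q (t + 1) ⁻¹' {a})
    (MeasurableSet.inter
      (((measurable_fst.comp measurable_snd).comp hc) (measurableSet_singleton b))
      ((measurable_fst.comp hc) (measurableSet_singleton a)))
  rw [setIntegral_congr_fun (g := fun _ => W.prob t a b y) (hb.inter ha), setIntegral_const,
    smul_eq_mul] at h1
  · rw [wordProb, wordProb, ← h1]
    congr 1
    ext ω
    simp only [Set.mem_inter_iff, Set.mem_preimage, Set.mem_singleton_iff, hist_succ_eq_snoc_iff]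
    tauto
  · rintro ω ⟨h1, h2⟩
    have h1' : hist q' t ω = b := h1
    have h2' : hist q (t + 1) ω = a := h2
    simp only [h1', h2']

/-- The encoder sees the states, but the joint law of the words only involves the conditional input
laws given past words. Hence the loop competes in the supremum defining `maxDirectedRate`. -/
theorem jointMass_eq (a₀ : A) (hq : ∀ t, Measurable (q t)) (T : ℕ)
    (ab : (Fin T → A) × (Fin T → B)) :
    jointMass W (inducedInputLaw P a₀ hq q') T ab = wordProb P q q' ab.1 ab.2 := by
  induction T with
  | zero =>
    have h1 : hist q' 0 ⁻¹' {ab.2} = Set.univ :=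
      Set.eq_univ_of_forall fun ω => Subsingleton.elim _ _
    have h2 : hist q 0 ⁻¹' {ab.1} = Set.univ :=
      Set.eq_univ_of_forall fun ω => Subsingleton.elim _ _
    simp [jointMass, wordProb, h1, h2]
  | succ T ih =>
    obtain ⟨a, b⟩ := ab
    have h1 : jointMass W (inducedInputLaw P a₀ hq q') (T + 1) (a, b) =
        jointMass W (inducedInputLaw P a₀ hq q') T (Fin.init a, Fin.init b) *
          ((inducedInputLaw P a₀ hq q').prob T (Fin.init a) (Fin.init b) (a (Fin.last T)) *
            W.prob T a (Fin.init b) (b (Fin.last T))) := by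
      rw [jointMass, Fin.prod_univ_castSucc]
      rfl
    rw [h1, ih, ← mul_assoc, wordProb_mul_inducedInputLaw, Fin.snoc_init_self,
      ← h.wordProb_snoc hf hA, Fin.snoc_init_self]

/-- The chain rule: by `wordProb_snoc` the probability of the extended words factors, and the
logarithm splits. Factors equal to zero are treated apart. -/
theorem rvEntropy_output_sub (t : ℕ) :
    rvEntropy P (fun ω => (q' t ω, (hist q (t + 1) ω, hist q' t ω))) -
      rvEntropy P (fun ω => (hist q (t + 1) ω, hist q' t ω)) =
      -(channelNegEnt P W q q' t / Real.log 2) := by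
  have e1 : ∀ a b, (fun ω => (hist q (t + 1) ω, hist q' t ω)) ⁻¹' {(a, b)} =
      hist q' t ⁻¹' {b} ∩ hist q (t + 1) ⁻¹' {a} := by
    intro a b
    ext ω
    simp only [Set.mem_inter_iff, Set.mem_preimage, Set.mem_singleton_iff, Prod.mk.injEq]
    tauto
  have e2 : ∀ a b y, (fun ω => (q' t ω, (hist q (t + 1) ω, hist q' t ω))) ⁻¹' {(y, (a, b))} =
      hist q' (t + 1) ⁻¹' {(Fin.snoc b y : Fin (t + 1) → B)} ∩ hist q (t + 1) ⁻¹' {a} := by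
    intro a b y
    ext ω
    simp only [Set.mem_inter_iff, Set.mem_preimage, Set.mem_singleton_iff, Prod.mk.injEq,
      hist_succ_eq_snoc_iff]
    tauto
  have e3 := fun a b y => h.wordProb_snoc hf hA (t := t) a b y
  simp only [wordProb] at e3
  rw [rvEntropy, rvEntropy, Fintype.sum_prod_type, Finset.sum_comm, neg_sub_neg]
  simp only [Fintype.sum_prod_type, e1, e2, e3]
  rw [channelNegEnt, Finset.sum_comm (s := (Finset.univ : Finset (Fin t → B))),
    ← Finset.sum_sub_distrib, Finset.sum_div, ← Finset.sum_neg_distrib]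
  refine Finset.sum_congr rfl fun a _ => ?_
  rw [← Finset.sum_sub_distrib, Finset.sum_div, ← Finset.sum_neg_distrib]
  refine Finset.sum_congr rfl fun b _ => ?_
  set m := P.real (hist q' t ⁻¹' {b} ∩ hist q (t + 1) ⁻¹' {a})
  have h1 : ∀ y, m * W.prob t a b y * Real.logb 2 (m * W.prob t a b y) =
      W.prob t a b y * (m * Real.logb 2 m) +
        m * (W.prob t a b y * Real.log (W.prob t a b y)) / Real.log 2 := by
    intro y
    by_cases hm : m = 0
    · simp [hm]
    by_cases hw : W.prob t a b y = 0
    · simp [hw]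
    rw [Real.logb, Real.logb, Real.log_mul hm hw]
    ring
  simp only [h1, Finset.sum_add_distrib, ← Finset.sum_mul, W.prob_sum, one_mul,
    ← Finset.sum_div, ← Finset.mul_sum]
  ring

/-- Each term is `H(q'_t | q'_{[0,t-1]}) - H(q'_t | q_{[0,t]}, q'_{[0,t-1]})`; the first parts
telescope to the entropy of the output word. -/
theorem directedInfo_eq (a₀ : A) (hq : ∀ t, Measurable (q t)) (T : ℕ) :
    directedInfo W (inducedInputLaw P a₀ hq q') T =
      rvEntropy P (hist q' T) + (∑ t ∈ Finset.range T, channelNegEnt P W q q' t) / Real.log 2 := by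
  have hY : ∀ ab : (Fin T → A) × (Fin T → B),
      MeasurableSet ((fun ω => (hist q T ω, hist q' T ω)) ⁻¹' {ab}) :=
    fun ab => ((h.measurable_hist_input hf T).prodMk (h.measurable_hist_output T))
      (measurableSet_singleton ab)
  have hmass : jointMass W (inducedInputLaw P a₀ hq q') T =
      fun ab => P.real ((fun ω => (hist q T ω, hist q' T ω)) ⁻¹' {ab}) := by
    funext ab
    rw [h.jointMass_eq hf hA, wordProb]
    congr 1
    ext ω
    simp only [Set.mem_inter_iff, Set.mem_preimage, Set.mem_singleton_iff, Prod.ext_iff]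
    tauto
  have hterm : ∀ t : Fin T, finCondMutualInfo (jointMass W (inducedInputLaw P a₀ hq q') T)
      (fun ab => ab.2 t) (fun ab => (initSeg t.2 ab.1 : Fin (t + 1) → A))
      (fun ab => (initSeg t.2.le ab.2 : Fin t → B)) =
      (rvEntropy P (hist q' (t + 1)) - rvEntropy P (hist q' t)) +
        channelNegEnt P W q q' t / Real.log 2 := by
    intro t
    rw [finCondMutualInfo, finCondEntropy, finCondEntropy, hmass]
    simp only [finEntropy_law hY]
    have h1 := h.rvEntropy_output_sub hf hA t
    have h2 := rvEntropy_prodMk_hist (P := P) q' t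
    change rvEntropy P (fun ω => (q' t ω, hist q' t ω)) - rvEntropy P (hist q' t) -
      (rvEntropy P (fun ω => (q' t ω, (hist q (t + 1) ω, hist q' t ω))) -
      rvEntropy P (fun ω => (hist q (t + 1) ω, hist q' t ω))) = _
    rw [h1, h2, sub_neg_eq_add]
  rw [directedInfo, Finset.sum_congr rfl fun t _ => hterm t,
    Fin.sum_univ_eq_sum_range (fun t => rvEntropy P (hist q' (t + 1)) - rvEntropy P (hist q' t) +
      channelNegEnt P W q q' t / Real.log 2) T, Finset.sum_add_distrib,
    Finset.sum_range_sub (fun t => rvEntropy P (hist q' t)), rvEntropy_hist_zero, sub_zero,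
    Finset.sum_div]

theorem le_maxDirectedRate (T : ℕ) :
    (rvEntropy P (hist q' T) + (∑ t ∈ Finset.range T, channelNegEnt P W q q' t) / Real.log 2) / T ≤
      maxDirectedRate W T := by
  have hΩ : Nonempty Ω := nonempty_of_isProbabilityMeasure P
  have hq : ∀ t, Measurable (q t) := fun t =>
    measurable_of_hist (h.measurable_hist_input hf (t + 1)) (Nat.lt_succ_self t)
  rw [← h.directedInfo_eq hf hA (q 0 hΩ.some) hq T]
  exact le_ciSup (bddAbove_directedInfo W T) _

end IsClosedLoop

end InducedInput

/-! ### Passing to the limit of the rates -/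

section Rates

theorem eq_coe_of_div_natCast_lt {h : EReal} {T : ℕ} (hT : 0 < T) {ε : ℝ}
    (hlt : h / (T : EReal) < (ε : EReal)) :
    h ≠ ⊤ ∧ ∀ r : ℝ, h = (r : EReal) → r / T < ε := by
  refine ⟨fun h0 => ?_, fun r hr => ?_⟩
  · rw [h0, EReal.top_div_of_pos_ne_top (by exact_mod_cast hT) (EReal.natCast_ne_top T)] at hlt
    exact not_top_lt hlt
  · rw [hr, ← EReal.coe_coe_eq_natCast, ← EReal.coe_div] at hlt
    exact_mod_cast hlt

/-- If the averages `a T` are bounded by rates `R T → C` up to `H T / T + c / T`, then sublinear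
growth of `H` along a subsequence, respectively of the whole sequence, bounds the lower,
respectively upper, limit of the averages. -/
theorem liminf_limsup_le_of_entropy_bound {a R : ℕ → ℝ} {H : ℕ → EReal} {C c M : ℝ}
    (hR : Tendsto R atTop (𝓝 C)) (ha : ∀ T, |a T| ≤ M)
    (hbound : ∀ T : ℕ, 0 < T → H T ≠ ⊤ →
      ∃ r : ℝ, H T = (r : EReal) ∧ a T ≤ R T + r / T + c / T) :
    (liminf (fun T : ℕ => H T / (T : EReal)) atTop ≤ 0 → liminf a atTop ≤ C) ∧
      (limsup (fun T : ℕ => H T / (T : EReal)) atTop ≤ 0 → limsup a atTop ≤ C) := by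
  have hbdd : IsBoundedUnder (· ≤ ·) atTop a :=
    isBoundedUnder_of ⟨M, fun T => (le_abs_self _).trans (ha T)⟩
  have hbdd' : IsBoundedUnder (· ≥ ·) atTop a :=
    isBoundedUnder_of ⟨-M, fun T => neg_le_of_abs_le (ha T)⟩
  have hstep : ∀ l : ℝ, C < l → ∃ ε : ℝ, 0 < ε ∧ ∃ l' < l,
      ∀ᶠ T : ℕ in atTop, H T / (T : EReal) < (ε : EReal) → a T ≤ l' := by
    intro l hl
    have h1 : Tendsto (fun T : ℕ => R T + (l - C) / 4 + c / T) atTop (𝓝 (C + (l - C) / 4 + 0)) :=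
      (hR.add_const _).add (tendsto_const_div_atTop_nhds_zero_nat c)
    have h2 := h1.eventually_lt_const (u := C + (l - C) / 2) (by linarith)
    -- A quarter of the gap `l - C` pays for the entropy term and another quarter for the
    -- convergence of `R` and `c / T`, which leaves `l'` strictly below `l`.
    refine ⟨(l - C) / 4, by linarith, C + (l - C) / 2, by linarith, ?_⟩
    filter_upwards [h2, eventually_gt_atTop 0] with T hT hpos hlt
    obtain ⟨hne, hreal⟩ := eq_coe_of_div_natCast_lt hpos hlt
    obtain ⟨r, hr, hle⟩ := hbound T hpos hne
    linarith [hreal r hr]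
  constructor
  · intro hlim
    by_contra! hcon
    obtain ⟨ε, hε, l', hl', hev⟩ := hstep _ hcon
    -- A small entropy rate occurs frequently, whereas `a T > l'` holds eventually; a common time is
    -- a contradiction.
    have hfreq := frequently_lt_of_liminf_lt (by isBoundedDefault)
      (hlim.trans_lt (EReal.coe_pos.2 hε))
    obtain ⟨T, hT1, hT2, hT3⟩ :=
      (hfreq.and_eventually (hev.and (eventually_lt_of_lt_liminf hl' hbdd'))).exists
    exact absurd (hT2 hT1) (not_le.2 hT3)
  · intro hlim
    by_contra! hcon
    obtain ⟨ε, hε, l', hl', hev⟩ := hstep _ hcon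
    have hev' := eventually_lt_of_limsup_lt (hlim.trans_lt (EReal.coe_pos.2 hε))
      (by isBoundedDefault)
    refine absurd (limsup_le_of_le hbdd'.isCoboundedUnder_le ?_) (not_le.2 hl')
    filter_upwards [hev, hev'] with T h1 h2
    exact h1 h2

end Rates

/-! ### Time averages of the logarithmic Jacobian -/

section Averages

variable {Ω : Type*} [mΩ : MeasurableSpace Ω] {P : Measure Ω} [IsProbabilityMeasure P]
  {A B : Type*} [Fintype A] [MeasurableSpace A] [MeasurableSingletonClass A]
  [Fintype B] [MeasurableSpace B] [MeasurableSingletonClass B] {N s : ℕ}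
  {f : Vec N → Vec N → Vec N} {Bm : Vec s →L[ℝ] Vec N} {ν : Measure (Vec N)}
  {W : Channel A B} {γ : Policy N s A B} {x w : ℕ → Ω → Vec N} {q : ℕ → Ω → A} {q' : ℕ → Ω → B}

omit [IsProbabilityMeasure P] in
theorem avgLogJac_eq (T : ℕ) :
    avgLogJac P f ν x T = (∑ t ∈ Finset.range T, meanLogJac P f ν x t) / Real.log 2 / T := by
  simp only [avgLogJac, meanLogJac, logJac, Real.logb, integral_div, ← Finset.sum_div]
  ring

/-- A probability average of a measurable function with values in `[L, M]` is in `[L, M]`. -/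
theorem integral_integral_mem_Icc {E : Type*} [MeasurableSpace E] {μ ν : Measure E}
    [IsProbabilityMeasure μ] [IsProbabilityMeasure ν] {g : E → E → ℝ} {L M : ℝ}
    (hg : Measurable (Function.uncurry g)) (h : ∀ y v, L ≤ g y v ∧ g y v ≤ M) :
    ∫ y, ∫ v, g y v ∂ν ∂μ ∈ Set.Icc L M := by
  have hb : ∀ y v, ‖g y v‖ ≤ max |L| |M| := fun y v =>
    abs_le_max_abs_abs (h y v).1 (h y v).2
  have hint : Integrable (Function.uncurry g) (μ.prod ν) :=
    Integrable.of_bound hg.aestronglyMeasurable _ (ae_of_all _ fun p => hb p.1 p.2)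
  have e : ∫ y, ∫ v, g y v ∂ν ∂μ = ∫ p, Function.uncurry g p ∂(μ.prod ν) :=
    (integral_prod _ hint).symm
  have hc : ∀ c : ℝ, ∫ _, c ∂(μ.prod ν) = c := fun c => by simp
  rw [e]
  constructor
  · rw [← hc L]
    exact integral_mono (integrable_const L) hint fun p => (h p.1 p.2).1
  · rw [← hc M]
    exact integral_mono hint (integrable_const M) fun p => (h p.1 p.2).2

theorem avgLogJac_mem_Icc [IsProbabilityMeasure ν] (hx : ∀ t, Measurable (x t))
    (hf : Measurable (Function.uncurry f)) (hdiff : ∀ v, Differentiable ℝ fun y => f y v)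
    {L M : ℝ} (hb : ∀ y v, L ≤ logJac f y v ∧ logJac f y v ≤ M) {T : ℕ} (hT : 0 < T) :
    avgLogJac P f ν x T ∈ Set.Icc L M := by
  have hT' : (0 : ℝ) < T := by exact_mod_cast hT
  have hterm : ∀ t, ∫ y, (∫ v, logJac f y v ∂ν) ∂(P.map (x t)) ∈ Set.Icc L M := by
    intro t
    have := Measure.isProbabilityMeasure_map (μ := P) (hx t).aemeasurable
    refine integral_integral_mem_Icc ?_ hb
    exact (Real.measurable_log.comp (measurable_jacDet hf hdiff).abs).div_const _
  rw [avgLogJac, one_div_mul_eq_div, Set.mem_Icc, le_div_iff₀ hT', div_le_iff₀ hT']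
  have h1 := Finset.card_nsmul_le_sum (Finset.range T) _ L fun t _ => (hterm t).1
  have h2 := Finset.sum_le_card_nsmul (Finset.range T) _ M fun t _ => (hterm t).2
  rw [Finset.card_range, nsmul_eq_mul, mul_comm] at h1 h2
  exact ⟨h1, h2⟩

theorem IsClosedLoop.avgLogJac_le (h : IsClosedLoop P f Bm ν W γ x w q q')
    (hf : Measurable (Function.uncurry f)) (hA : IsClassA P W (x 0) w q q')
    (hdiff : ∀ v, Differentiable ℝ fun y => f y v)
    (hbij : ∀ v, Function.Bijective fun y => f y v) (hne : ∀ y v, jacDet f y v ≠ 0)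
    {K : ℝ} (hK : ∀ y v, |Real.log (|jacDet f y v|)| ≤ K)
    (h0 : HasFiniteDiffEntropy (P.map (x 0))) {T : ℕ} (hT : 0 < T)
    (htop : diffEntropy (P.map (x T)) ≠ ⊤) :
    ∃ r : ℝ, diffEntropy (P.map (x T)) = (r : EReal) ∧
      avgLogJac P f ν x T ≤
        maxDirectedRate W T + r / T + negEnt (P.map (x 0)) / Real.log 2 / T := by
  have hl : 0 < Real.log 2 := Real.log_pos one_lt_two
  have hT' : (0 : ℝ) < T := by exact_mod_cast hT
  obtain ⟨hT1, he, hineq⟩ := h.entropy_inequality hf hA hdiff hbij hne hK h0 T htop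
  refine ⟨_, he, ?_⟩
  have h1 := h.le_maxDirectedRate hf hA T
  rw [avgLogJac_eq, div_le_iff₀ hT']
  rw [div_le_iff₀ hT'] at h1
  have e1 : rvEntropy P (hist q' T) =
      -(∑ b, P.real (hist q' T ⁻¹' {b}) * Real.log (P.real (hist q' T ⁻¹' {b}))) / Real.log 2 := by
    simp only [rvEntropy, Real.logb, Finset.sum_div, neg_div, mul_div_assoc]
  rw [Finset.sum_sub_distrib] at hineq
  have e2 := div_le_div_of_nonneg_right hineq hl.le
  have e3 : (maxDirectedRate W T + hT1 / Real.log 2 / T +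
      negEnt (P.map (x 0)) / Real.log 2 / T) * T = maxDirectedRate W T * T + hT1 / Real.log 2 +
        negEnt (P.map (x 0)) / Real.log 2 := by
    field_simp
  rw [e3]
  rw [e1] at h1
  simp only [add_div, sub_div, neg_div] at e2 h1
  linarith

end Averages

end NetworkedControl

/-! ### The main theorem -/

theorem mainTheorem3 {Ω : Type*} [MeasurableSpace Ω] (P : MeasureTheory.Measure Ω)
    [MeasureTheory.IsProbabilityMeasure P] {A B : Type*}
    [Fintype A] [MeasurableSpace A] [MeasurableSingletonClass A]
    [Fintype B] [MeasurableSpace B] [MeasurableSingletonClass B]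
    (N s : ℕ)
    (f : NetworkedControl.Vec N → NetworkedControl.Vec N → NetworkedControl.Vec N)
    (Bm : NetworkedControl.Vec s →L[ℝ] NetworkedControl.Vec N)
    (ν : MeasureTheory.Measure (NetworkedControl.Vec N))
    (hf_meas : Measurable (Function.uncurry f))
    (hf_C1 : ∀ w, ContDiff ℝ 1 (fun x => f x w))
    (hf_inv : ∀ w, Function.Bijective (fun x => f x w))
    (L₁ M₁ : ℝ)
    (hf_bound : ∀ x w, NetworkedControl.jacDet f x w ≠ 0 ∧
      L₁ ≤ NetworkedControl.logJac f x w ∧ NetworkedControl.logJac f x w ≤ M₁)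
    (W : NetworkedControl.Channel A B)
    (γ : NetworkedControl.Policy N s A B)
    (x w : ℕ → Ω → NetworkedControl.Vec N) (q : ℕ → Ω → A) (q' : ℕ → Ω → B)
    (hloop : NetworkedControl.IsClosedLoop P f Bm ν W γ x w q q')
    (hA : NetworkedControl.IsClassA P W (x 0) w q q')
    (hx0 : NetworkedControl.HasFiniteDiffEntropy (P.map (x 0))) :
    (liminf (fun t : ℕ => NetworkedControl.diffEntropy (P.map (x t)) / (t : EReal)) atTop ≤ 0 →
      liminf (fun T : ℕ => NetworkedControl.avgLogJac P f ν x T) atTop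
        ≤ NetworkedControl.feedbackCapacity W) ∧
    (limsup (fun t : ℕ => NetworkedControl.diffEntropy (P.map (x t)) / (t : EReal)) atTop ≤ 0 →
      limsup (fun T : ℕ => NetworkedControl.avgLogJac P f ν x T) atTop
        ≤ NetworkedControl.feedbackCapacity W) ∧
    ((liminf (fun t : ℕ => NetworkedControl.diffEntropy (P.map (x t)) / (t : EReal)) atTop ≤ 0 ∨
      limsup (fun t : ℕ => NetworkedControl.diffEntropy (P.map (x t)) / (t : EReal)) atTop ≤ 0) →
      (⨅ p : NetworkedControl.Vec N × NetworkedControl.Vec N,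
        NetworkedControl.logJac f p.1 p.2) ≤ NetworkedControl.feedbackCapacity W) := by
  have hl : 0 < Real.log 2 := Real.log_pos one_lt_two
  have hdiff : ∀ v, Differentiable ℝ fun y => f y v :=
    fun v => (hf_C1 v).differentiable one_ne_zero
  have hν : IsProbabilityMeasure ν := hloop.isProbabilityMeasure_noise
  have hx := hloop.measurable_x hf_meas
  have hb := fun y v => (hf_bound y v).2
  -- The factor `log 2` converts the bounds from bits to nats.
  have hK : ∀ y v, |Real.log (|NetworkedControl.jacDet f y v|)| ≤
      max |L₁| |M₁| * Real.log 2 := by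
    intro y v
    have h1 := abs_le_max_abs_abs (hb y v).1 (hb y v).2
    rwa [NetworkedControl.logJac, Real.logb, abs_div, abs_of_pos hl, div_le_iff₀ hl] at h1
  have habs : ∀ T, |NetworkedControl.avgLogJac P f ν x T| ≤ max |L₁| |M₁| := by
    intro T
    rcases T.eq_zero_or_pos with rfl | hT
    · simp [NetworkedControl.avgLogJac]
    · have h1 := NetworkedControl.avgLogJac_mem_Icc (P := P) (ν := ν) hx hf_meas hdiff hb hT
      exact abs_le_max_abs_abs h1.1 h1.2
  obtain ⟨ha, hb'⟩ := NetworkedControl.liminf_limsup_le_of_entropy_bound hA.capacity habs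
    fun T hT htop => hloop.avgLogJac_le hf_meas hA hdiff hf_inv (fun y v => (hf_bound y v).1)
      hK hx0 hT htop
  refine ⟨ha, hb', fun hor => ?_⟩
  -- Either hypothesis gives the weaker one on the lower limit, so the bound by `L` follows from a).
  have hliminf : liminf (fun t : ℕ => NetworkedControl.diffEntropy (P.map (x t)) / (t : EReal))
      atTop ≤ 0 := by
    rcases hor with h | h
    · exact h
    · exact (liminf_le_limsup).trans h
  refine le_trans ?_ (ha hliminf)
  have hbdd : BddBelow (Set.range fun p : NetworkedControl.Vec N × NetworkedControl.Vec N =>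
      NetworkedControl.logJac f p.1 p.2) := by
    refine ⟨L₁, ?_⟩
    rintro _ ⟨p, rfl⟩
    exact (hb p.1 p.2).1
  have hcob : IsCoboundedUnder (· ≥ ·) atTop
      fun T => NetworkedControl.avgLogJac P f ν x T :=
    (isBoundedUnder_of (r := (· ≤ ·)) ⟨max |L₁| |M₁|,
      fun T => (le_abs_self _).trans (habs T)⟩).isCoboundedUnder_ge
  refine le_liminf_of_le hcob ?_
  -- At `T = 0` the average is `0` by convention and may lie below the infimum.
  filter_upwards [eventually_gt_atTop 0] with T hT
  exact (NetworkedControl.avgLogJac_mem_Icc (P := P) (ν := ν) hx hf_meas hdiff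
    (fun y v => ⟨ciInf_le hbdd (y, v), (hb y v).2⟩) hT).1
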